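/- **Theorem.** Let $F$ be a finite field with $q$ elements, let $\ell\ge 2$, and let $G$ be an invertible $\ell\times\ell$ matrix over $F$, acting on row vectors as the kernel $u\mapsto uG$. Let $W$ be a discrete memoryless channel with input alphabet $F$ and an at most countable output alphabet $\mathcal Y$, i.e. a probability distribution $W(\cdot\mid x)$ on $\mathcal Y$ for every $x\in F$. Put $$I(W)=\sum_{x\in F}\sum_{y}\frac1q W(y\mid x)\log_q\frac{W(y\mid x)}{\frac1q\sum_{x'}W(y\mid x')},\qquad Z_{x,x'}(W)=\sum_y\sqrt{W(y\mid x)W(y\mid x')},$$ $$Z(W)=\frac1{q(q-1)}\sum_{x\ne x'}Z_{x,x'}(W),\qquad Z_{\min}(W)=\min_{x,x'}Z_{x,x'}(W).$$ For $0\le i\le \ell-1$ let $W^{(i)}$ be the channel with input $u_i\in F$ and output $(y_0^{\ell-1},u_0^{i-1})\in\mathcal Y^\ell\times F^i$ given by $$W^{(i)}(y_0^{\ell-1},u_0^{i-1}\mid u_i)=\frac1{q^{\ell-1}}\sum_{u_{i+1},\dots,u_{\ell-1}\in F}\ \prod_{j=0}^{\ell-1}W\big(y_j\mid (u_0^{\ell-1}G)_j\big).$$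 Let $B_1,B_2,\dots$ be independent random variables, uniform on $\{0,\dots,\ell-1\}$, on a probability space $(\Omega,\mathcal{A},P)$, and let $W_n=W^{(B_1)\cdots(B_n)}$ be obtained from $W_0=W$ by $W_{n+1}=W_n^{(B_{n+1})}$. Let $I_\infty$ be the almost sure limit of $I(W_n)$ (which always exists), and assume that $P(I_\infty\in\{0,1\})=1$. Let $d$ be the Hamming distance on $F^\ell$, let $$D^{[i]}=\min\big\{d(vG,wG): v,w\in F^\ell,\ v_j=w_j=0 \text{ for } j<i,\ v_i=0,\ w_i=1\big\},$$ $$E(G)=\frac1\ell\sum_{i=0}^{\ell-1}\log_\ell D^{[i]},\qquad V(G)=\frac1\ell\sum_{i=0}^{\ell-1}\big(\log_\ell D^{[i]}-E(G)\big)^2,\qquad Q(t)=\frac1{\sqrt{2\pi}}\int_t^\infty e^{-x^2/2}\,dx .$$ Then for every $t\in\mathbb R$ and every $f:\mathbb N\to\mathbb R$ with $f(n)=o(\sqrt n)$, $$\liminf_{n\to\infty}P\Big(Z(W_n)<2^{-\ell^{E(G)n+t\sqrt{V(G)n}+f(n)}}\Big)\ \ge\ I(W)\,Q(t),$$ and if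 moreover $Z_{\min}(W)>0$, then $$\limsup_{n\to\infty}P\Big(Z(W_n)<2^{-\ell^{E(G)n+t\sqrt{V(G)n}+f(n)}}\Big)\ \le\ I(W)\,Q(t).$$ -/

import Mathlib

open MeasureTheory ProbabilityTheory Filter Topology
open scoped Matrix

universe u

/-- A discrete memoryless channel with input alphabet `X`: an output alphabet `Out`, at most
countable, and for every input `x` a probability distribution `prob x` on `Out`;
`prob x y` is the transition probability `W(y | x)`. -/
structure DMC (X : Type u) where
  Out : Type u
  countable_out : Countable Out
  prob : X → Out → ℝ
  prob_nonneg : ∀ x y, 0 ≤ prob x y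
  hasSum_prob : ∀ x, HasSum (prob x) 1

namespace DMC

/-- A product of finitely many families summing to `1` sums to `1`. -/
theorem hasSum_prod_pi {α : Type u} (n : ℕ) (f : Fin n → α → ℝ)
    (h0 : ∀ i a, 0 ≤ f i a) (h1 : ∀ i, HasSum (f i) 1) :
    HasSum (fun y : Fin n → α => ∏ j, f j (y j)) 1 := by
  induction n with
  | zero =>
    simp
  | succ n ih =>
    have h := ih (fun i => f i.succ) (fun i a => h0 i.succ a) (fun i => h1 i.succ)
    have hs := (h1 0).summable.mul_of_nonneg h.summable (fun a => h0 0 a)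
      (fun y => Finset.prod_nonneg fun j _ => h0 j.succ (y j))
    have hm := (h1 0).mul h hs
    rw [← (Fin.consEquiv (fun _ : Fin (n + 1) => α)).hasSum_iff]
    simpa [Function.comp_def, Fin.prod_univ_succ, Fin.consEquiv] using hm

variable {X : Type u}

/-- The `ℓ`-fold product channel `W^ℓ(y | x) = ∏ i, W(y i | x i)`. -/
def prodProb (W : DMC X) {ℓ : ℕ} (x : Fin ℓ → X) (y : Fin ℓ → W.Out) : ℝ :=
  ∏ i, W.prob (x i) (y i)

variable [Fintype X] [DecidableEq X]

/-- The transition probabilities of the subchannel `W^(i)` induced by the kernel `g`: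
`W^(i)(y, u_0^{i-1} | u_i) = q^{-(ℓ-1)} ∑_{u_{i+1}^{ℓ-1}} W^ℓ(y | g(u_0^{ℓ-1}))`.
The output is the pair `(y, u_0^{i-1})`; the sum is over all full vectors `v` with
prefix `u_0^{i-1}` and `i`-th entry `u_i`. -/
noncomputable def subProb (W : DMC X) {ℓ : ℕ} (g : (Fin ℓ → X) → (Fin ℓ → X)) (i : Fin ℓ)
    (x : X) (p : (Fin ℓ → W.Out) × ({j : Fin ℓ // j < i} → X)) : ℝ :=
  ((Fintype.card X : ℝ) ^ (ℓ - 1))⁻¹ *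
    ∑ v : Fin ℓ → X with (∀ j : {j : Fin ℓ // j < i}, v j = p.2 j) ∧ v i = x,
      W.prodProb (g v) p.1

/-- The number of vectors of length `ℓ` with a prescribed `i`-th entry is `q^(ℓ-1)`. -/
theorem card_filter_apply_eq {ℓ : ℕ} (i : Fin ℓ) (x : X) :
    (Finset.univ.filter fun v : Fin ℓ → X => v i = x).card = Fintype.card X ^ (ℓ - 1) := by
  classical
  obtain ⟨n, rfl⟩ : ∃ n, ℓ = n + 1 := ⟨ℓ - 1, by have := i.pos; omega⟩
  rw [← Fintype.card_subtype]
  have e : {v : Fin (n + 1) → X // v i = x} ≃ (Fin n → X) :=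
    { toFun := fun v => i.removeNth v.1
      invFun := fun w => ⟨i.insertNth x w, by simp⟩
      left_inv := by
        rintro ⟨v, rfl⟩
        simp
      right_inv := by
        intro w
        simp }
  rw [Fintype.card_congr e]
  simp

theorem hasSum_subProb (W : DMC X) {ℓ : ℕ} (g : (Fin ℓ → X) → (Fin ℓ → X)) (i : Fin ℓ) (x : X) :
    HasSum (W.subProb g i x) 1 := by
  have hq : ((Fintype.card X : ℝ) ^ (ℓ - 1)) ≠ 0 :=
    pow_ne_zero _ (Nat.cast_ne_zero.mpr (Fintype.card_pos_iff.mpr ⟨x⟩).ne')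
  have key : ∀ v : Fin ℓ → X, HasSum
      (fun p : (Fin ℓ → W.Out) × ({j : Fin ℓ // j < i} → X) =>
        if (∀ j : {j : Fin ℓ // j < i}, v j = p.2 j) ∧ v i = x then
          W.prodProb (g v) p.1 else 0) (if v i = x then 1 else 0) := by
    intro v
    by_cases hv : v i = x
    · simp only [hv, and_true, if_true]
      have h1 := hasSum_prod_pi ℓ (fun j => W.prob (g v j)) (fun j => W.prob_nonneg _)
        (fun j => W.hasSum_prob _)
      have hinj : Function.Injective
          (fun y : Fin ℓ → W.Out => (y, fun j : {j : Fin ℓ // j < i} => v j)) :=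
        fun a b h => (Prod.ext_iff.1 h).1
      rw [← hinj.hasSum_iff]
      · simpa [Function.comp_def, prodProb] using h1
      · rintro ⟨y, w⟩ hw
        refine if_neg fun h => hw ⟨y, ?_⟩
        simp only [Prod.mk.injEq, true_and]
        exact funext h
    · simp only [hv, and_false, if_false]
      exact hasSum_zero
  have hs := (hasSum_sum (s := Finset.univ) fun v _ => key v).mul_left
    ((Fintype.card X : ℝ) ^ (ℓ - 1))⁻¹
  have hc : (∑ v : Fin ℓ → X, if v i = x then (1 : ℝ) else 0)
      = (Fintype.card X : ℝ) ^ (ℓ - 1) := by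
    rw [Finset.sum_boole, card_filter_apply_eq]
    push_cast
    rfl
  rw [hc, inv_mul_cancel₀ hq] at hs
  have heq : W.subProb g i x = fun p => ((Fintype.card X : ℝ) ^ (ℓ - 1))⁻¹ *
      ∑ v : Fin ℓ → X, if (∀ j : {j : Fin ℓ // j < i}, v j = p.2 j) ∧ v i = x then
        W.prodProb (g v) p.1 else 0 := by
    funext p
    rw [subProb, Finset.sum_filter]
  rw [heq]
  exact hs

/-- The subchannel `W^(i)` of `W` induced by the kernel `g`. -/
noncomputable def sub (W : DMC X) {ℓ : ℕ} (g : (Fin ℓ → X) → (Fin ℓ → X)) (i : Fin ℓ) :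
    DMC X where
  Out := (Fin ℓ → W.Out) × ({j : Fin ℓ // j < i} → X)
  countable_out := by
    have := W.countable_out
    infer_instance
  prob := W.subProb g i
  prob_nonneg := fun x p => by
    refine mul_nonneg (by positivity) (Finset.sum_nonneg fun v _ => ?_)
    exact Finset.prod_nonneg fun j _ => W.prob_nonneg _ _
  hasSum_prob := W.hasSum_subProb g i

/-- The iterated subchannel `W^{(b 0)(b 1)⋯(b (n-1))}`. -/
noncomputable def iter (W : DMC X) {ℓ : ℕ} (g : (Fin ℓ → X) → (Fin ℓ → X)) (b : ℕ → Fin ℓ) :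
    ℕ → DMC X
  | 0 => W
  | n + 1 => (iter W g b n).sub g (b n)

/-- The symmetric capacity `I(W)`, with logarithms to base `q = |X|`. -/
noncomputable def symCap (W : DMC X) : ℝ :=
  ∑ x, ∑' y, (1 / (Fintype.card X : ℝ)) * W.prob x y *
    Real.logb (Fintype.card X)
      (W.prob x y / ((1 / (Fintype.card X : ℝ)) * ∑ x', W.prob x' y))

/-- The Bhattacharyya parameter `Z_{x,x'}(W)` between two inputs. -/
noncomputable def bhatt₂ (W : DMC X) (x x' : X) : ℝ :=
  ∑' y, Real.sqrt (W.prob x y * W.prob x' y)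

/-- The Bhattacharyya parameter `Z(W)`: the average of `Z_{x,x'}(W)` over ordered pairs of
distinct inputs. -/
noncomputable def bhatt (W : DMC X) : ℝ :=
  (1 / ((Fintype.card X : ℝ) * ((Fintype.card X : ℝ) - 1))) *
    ∑ p : X × X with p.1 ≠ p.2, W.bhatt₂ p.1 p.2

/-- `Z_min(W)`, the minimum of `Z_{x,x'}(W)` over all pairs of inputs
(the infimum of a finite family). -/
noncomputable def bhattMin (W : DMC X) : ℝ :=
  ⨅ p : X × X, W.bhatt₂ p.1 p.2

/-- `I_∞`, the limit of `I(W^{(b 0)⋯(b (n-1))})` as `n → ∞`. For independent uniform `b` the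
sequence is a bounded martingale, hence converges almost surely; writing the limit as a `limsup`
makes `I_∞` defined on every path without presupposing this convergence. -/
noncomputable def limCap (W : DMC X) {ℓ : ℕ} (g : (Fin ℓ → X) → (Fin ℓ → X))
    (b : ℕ → Fin ℓ) : ℝ :=
  limsup (fun n => (W.iter g b n).symCap) atTop

end DMC

/-- The kernel `u ↦ u G` represented by a square matrix `G` acting on row vectors. -/
def linKernel {F : Type u} [Field F] {ℓ : ℕ} (G : Matrix (Fin ℓ) (Fin ℓ) F) :
    (Fin ℓ → F) → (Fin ℓ → F) :=
  fun u => u ᵥ* G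

/-- The partial distance `D^{[i]}_{x,x'}(u_0^{i-1})` of a kernel: the minimum Hamming distance
between `g(u_0^{i-1}, x, v_{i+1}^{ℓ-1})` and `g(u_0^{i-1}, x', w_{i+1}^{ℓ-1})`.
Only the entries of `u` with index below `i` are used. -/
noncomputable def partialDist {X : Type u} [DecidableEq X] {ℓ : ℕ}
    (g : (Fin ℓ → X) → (Fin ℓ → X)) (i : Fin ℓ) (x x' : X) (u : Fin ℓ → X) : ℕ :=
  sInf {d | ∃ v w : Fin ℓ → X, (∀ j < i, v j = u j) ∧ (∀ j < i, w j = u j) ∧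
    v i = x ∧ w i = x' ∧ d = hammingDist (g v) (g w)}

section Exponent

variable {F : Type u} [Field F] [DecidableEq F] {ℓ : ℕ}

/-- The partial distance `D^{[i]}` of a matrix `G` (zero prefix, inputs `0` and `1`). -/
noncomputable def matrixDist (G : Matrix (Fin ℓ) (Fin ℓ) F) (i : Fin ℓ) : ℕ :=
  partialDist (linKernel G) i 0 1 0

/-- The exponent `E(G) = (1/ℓ) ∑ i, log_ℓ D^{[i]}`. -/
noncomputable def exponent (G : Matrix (Fin ℓ) (Fin ℓ) F) : ℝ :=
  (1 / (ℓ : ℝ)) * ∑ i, Real.logb ℓ (matrixDist G i)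

/-- The second exponent `V(G) = (1/ℓ) ∑ i, (log_ℓ D^{[i]} - E(G))²`. -/
noncomputable def secondExponent (G : Matrix (Fin ℓ) (Fin ℓ) F) : ℝ :=
  (1 / (ℓ : ℝ)) * ∑ i, (Real.logb ℓ (matrixDist G i) - exponent G) ^ 2

end Exponent

/-- The Gaussian tail `Q(t) = (2π)^{-1/2} ∫_t^∞ exp(-x²/2) dx`. -/
noncomputable def gaussianQ (t : ℝ) : ℝ :=
  (1 / Real.sqrt (2 * Real.pi)) * ∫ x in Set.Ioi t, Real.exp (-(x ^ 2) / 2)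

/-! Write `Z_max` and `Z_min` for the extreme pairwise Bhattacharyya parameters and `S_n = ∑_{k<n}
log_ℓ D^{[B_k]}`. One polarization step satisfies `Z_max(W^(i)) ≤ q^ℓ Z_max(W)^{D^{[i]}}`
(`bhattMax_sub_le`) and `Z_min(W^(i)) ≥ Z_min(W)^{D^{[i]}}` (`pow_bhattMin_le`). Hence `log_ℓ(-log_2
Z(W_n))` follows the random walk `S_n`, whose increments have mean `E(G)` and variance `V(G)`, and
the factor `Q(t)` is the central limit theorem for `S_n`.

The second inequality has no constant, so `Z(W_n) ≥ 2^{-ℓ^{S_n+R}}` on every path with one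
deterministic `R`, provided `Z_min(W) > 0`. In the first, the constant `q^ℓ` is harmless only once
`Z_max` is small. This happens on `{I_∞ = 1}`: there `Z_max → 0`, the strong law gives `S_n` a
positive drift, the errors become summable, and `Z(W_n) ≤ 2^{-ℓ^{S_n-R}}` eventually, with a finite
`R` depending on the path (`le_two_rpow_of_recursion`). On `{I_∞ = 0}` one has `Z(W_n) → 1`, so the
event in question eventually fails. Both limits come from outputwise inequalities between capacity
and Bhattacharyya terms.

The capacities form a bounded martingale (`sum_symCap_sub` is the chain rule), so `P(I_∞ = 1) =
I(W)`. This event is not independent of the walk, but it is approximated by events in the first `m`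
indices, and `m` bounded increments do not affect the limit law; `tendsto_inter_of_approx` therefore
yields the product `I(W) Q(t)`.

Some partial distance is always one, so `V(G) > 0` unless all of them are. In that degenerate case
`Z` is invariant under the kernel, polarization forces `I(W) ∈ {0,1}`, and the probabilities are
identically 0 or 1. -/

/-! ### Product sums, pairwise Bhattacharyya parameters and sums over subchannel outputs -/

namespace DMC

/-- A product of finitely many summable real families sums to the product of the sums. -/
theorem hasSum_pi_prod {α : Type u} (n : ℕ) (f : Fin n → α → ℝ) (a : Fin n → ℝ)
    (h : ∀ i, HasSum (f i) (a i)) :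
    HasSum (fun y : Fin n → α => ∏ j, f j (y j)) (∏ j, a j) := by
  induction n with
  | zero => simp
  | succ n ih =>
    have ht := ih (fun i => f i.succ) (fun i => a i.succ) (fun i => h i.succ)
    have hs := summable_mul_of_summable_norm (h 0).summable.norm ht.summable.norm
    have hm := (h 0).mul ht hs
    rw [← (Fin.consEquiv (fun _ : Fin (n + 1) => α)).hasSum_iff]
    simpa [Function.comp_def, Fin.prod_univ_succ, Fin.consEquiv] using hm

variable {X : Type u}

theorem prodProb_nonneg (W : DMC X) {ℓ : ℕ} (x : Fin ℓ → X) (y : Fin ℓ → W.Out) :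
    0 ≤ W.prodProb x y :=
  Finset.prod_nonneg fun _ _ => W.prob_nonneg _ _

theorem hasSum_prodProb (W : DMC X) {ℓ : ℕ} (x : Fin ℓ → X) : HasSum (W.prodProb x) 1 :=
  hasSum_prod_pi ℓ (fun j => W.prob (x j)) (fun _ => W.prob_nonneg _) fun _ => W.hasSum_prob _

theorem card_pos_of_mem [Fintype X] (x : X) : (0 : ℝ) < Fintype.card X :=
  Nat.cast_pos.2 (Fintype.card_pos_iff.2 ⟨x⟩)

/-! ### The pairwise Bhattacharyya parameters -/

theorem sqrt_mul_le_half_add {a b : ℝ} (ha : 0 ≤ a) (hb : 0 ≤ b) :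
    Real.sqrt (a * b) ≤ (a + b) / 2 := by
  rw [Real.sqrt_le_left (by positivity)]
  nlinarith [sq_nonneg (a - b)]

theorem hasSum_bhatt₂ (W : DMC X) (x x' : X) :
    HasSum (fun y => Real.sqrt (W.prob x y * W.prob x' y)) (W.bhatt₂ x x') := by
  refine Summable.hasSum (Summable.of_nonneg_of_le (fun _ => Real.sqrt_nonneg _)
    (fun y => sqrt_mul_le_half_add (W.prob_nonneg x y) (W.prob_nonneg x' y)) ?_)
  exact ((W.hasSum_prob x).summable.add (W.hasSum_prob x').summable).div_const 2

theorem bhatt₂_nonneg (W : DMC X) (x x' : X) : 0 ≤ W.bhatt₂ x x' :=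
  tsum_nonneg fun _ => Real.sqrt_nonneg _

theorem bhatt₂_le_one (W : DMC X) (x x' : X) : W.bhatt₂ x x' ≤ 1 := by
  have h := hasSum_le
    (fun y => sqrt_mul_le_half_add (W.prob_nonneg x y) (W.prob_nonneg x' y))
    (W.hasSum_bhatt₂ x x') (((W.hasSum_prob x).add (W.hasSum_prob x')).div_const 2)
  linarith

theorem bhatt₂_self (W : DMC X) (x : X) : W.bhatt₂ x x = 1 := by
  have h : (fun y => Real.sqrt (W.prob x y * W.prob x y)) = W.prob x := by
    funext y
    exact Real.sqrt_mul_self (W.prob_nonneg x y)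
  rw [bhatt₂, h]
  exact (W.hasSum_prob x).tsum_eq

theorem hasSum_sqrt_prodProb (W : DMC X) {ℓ : ℕ} (a b : Fin ℓ → X) :
    HasSum (fun y => Real.sqrt (W.prodProb a y * W.prodProb b y))
      (∏ j, W.bhatt₂ (a j) (b j)) := by
  have h := hasSum_pi_prod ℓ
    (fun j y => Real.sqrt (W.prob (a j) y * W.prob (b j) y)) _
    fun j => W.hasSum_bhatt₂ (a j) (b j)
  convert! h using 2 with y
  rw [prodProb, prodProb, ← Finset.prod_mul_distrib, Real.sqrt_prod]
  exact fun j _ => mul_nonneg (W.prob_nonneg _ _) (W.prob_nonneg _ _)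

theorem prod_bhatt₂_eq (W : DMC X) [DecidableEq X] {ℓ : ℕ} (a b : Fin ℓ → X) :
    ∏ j, W.bhatt₂ (a j) (b j) = ∏ j with a j ≠ b j, W.bhatt₂ (a j) (b j) := by
  rw [Finset.prod_filter]
  refine Finset.prod_congr rfl fun j _ => ?_
  split_ifs with h
  · rfl
  · rw [not_not.1 h, bhatt₂_self]

theorem prod_bhatt₂_le (W : DMC X) [DecidableEq X] {z : ℝ}
    (hz : ∀ x x', x ≠ x' → W.bhatt₂ x x' ≤ z) {ℓ : ℕ} (a b : Fin ℓ → X) :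
    ∏ j, W.bhatt₂ (a j) (b j) ≤ z ^ hammingDist a b := by
  rw [prod_bhatt₂_eq, hammingDist, ← Finset.prod_const]
  exact Finset.prod_le_prod (fun _ _ => W.bhatt₂_nonneg _ _)
    fun j hj => hz _ _ (Finset.mem_filter.1 hj).2

theorem le_prod_bhatt₂ (W : DMC X) [DecidableEq X] {z : ℝ} (hz0 : 0 ≤ z)
    (hz : ∀ x x', z ≤ W.bhatt₂ x x') {ℓ : ℕ} (a b : Fin ℓ → X) :
    z ^ hammingDist a b ≤ ∏ j, W.bhatt₂ (a j) (b j) := by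
  rw [prod_bhatt₂_eq, hammingDist, ← Finset.prod_const]
  exact Finset.prod_le_prod (fun _ _ => hz0) fun j _ => hz _ _

/-! ### Sums over the outputs of a subchannel -/

variable [Fintype X] [DecidableEq X]

/-- The vectors with prefix `u` below `i` and `i`-th entry `x`. -/
def extensions {ℓ : ℕ} (i : Fin ℓ) (x : X) (u : {j : Fin ℓ // j < i} → X) :
    Finset (Fin ℓ → X) :=
  {v : Fin ℓ → X | (∀ j : {j : Fin ℓ // j < i}, v j = u j) ∧ v i = x}

theorem mem_extensions {ℓ : ℕ} {i : Fin ℓ} {x : X} {u : {j : Fin ℓ // j < i} → X}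
    {v : Fin ℓ → X} :
    v ∈ extensions i x u ↔ (∀ j : {j : Fin ℓ // j < i}, v j = u j) ∧ v i = x := by
  simp [extensions]

theorem subProb_eq (W : DMC X) {ℓ : ℕ} (g : (Fin ℓ → X) → (Fin ℓ → X)) (i : Fin ℓ) (x : X)
    (p : (Fin ℓ → W.Out) × ({j : Fin ℓ // j < i} → X)) :
    W.subProb g i x p = ((Fintype.card X : ℝ) ^ (ℓ - 1))⁻¹ *
      ∑ v ∈ extensions i x p.2, W.prodProb (g v) p.1 := rfl

/-- A full input `v` with `v i = x` extends exactly one prefix, so the double summation over outputs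
`(y, u)` and extensions of `u` reaches each pair `(y, v)` once. All sums over outputs of a
subchannel are evaluated this way. -/
theorem hasSum_sum_extensions {α : Type u} {ℓ : ℕ} (i : Fin ℓ) (x : X)
    (φ : (Fin ℓ → α) → (Fin ℓ → X) → ℝ) (a : (Fin ℓ → X) → ℝ)
    (h : ∀ v, HasSum (fun y => φ y v) (a v)) :
    HasSum (fun p : (Fin ℓ → α) × ({j : Fin ℓ // j < i} → X) =>
      ∑ v ∈ extensions i x p.2, φ p.1 v) (∑ v : Fin ℓ → X with v i = x, a v) := by
  have key : ∀ v : Fin ℓ → X, HasSum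
      (fun p : (Fin ℓ → α) × ({j : Fin ℓ // j < i} → X) =>
        if (∀ j : {j : Fin ℓ // j < i}, v j = p.2 j) ∧ v i = x then
          φ p.1 v else 0) (if v i = x then a v else 0) := by
    intro v
    by_cases hv : v i = x
    · simp only [hv, and_true, if_true]
      have hinj : Function.Injective
          (fun y : Fin ℓ → α => (y, fun j : {j : Fin ℓ // j < i} => v j)) :=
        fun a b h => (Prod.ext_iff.1 h).1
      rw [← hinj.hasSum_iff]
      · simpa [Function.comp_def] using h v
      · rintro ⟨y, w⟩ hw
        refine if_neg fun h => hw ⟨y, ?_⟩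
        simp only [Prod.mk.injEq, true_and]
        exact funext h
    · simp only [hv, and_false, if_false]
      exact hasSum_zero
  have hs := hasSum_sum (s := Finset.univ) fun v _ => key v
  rw [Finset.sum_filter]
  convert! hs using 2 with p
  rw [extensions, Finset.sum_filter]

end DMC

/-! ### Capacity against Bhattacharyya parameters -/

/-- Both `r` and `1/r`, for `r = qa/b`, are at most `qb/a`, and the factor `p ≤ a` cancels the
denominator. The bound is linear in `b`, which makes the information terms summable over an infinite
alphabet. -/
theorem abs_mul_log_div_le {p a b q : ℝ} (hq : 1 ≤ q) (hp : 0 ≤ p) (hpa : p ≤ a) (hab : a ≤ b) :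
    |p * Real.log (q * a / b)| ≤ q * b := by
  have hq0 : 0 < q := by linarith
  rcases (hp.trans hpa).eq_or_lt with ha | ha
  · have : p = 0 := by linarith
    simp only [this, zero_mul, abs_zero]
    exact mul_nonneg hq0.le (by linarith)
  have hb : 0 < b := by linarith
  have hr : 0 < q * a / b := by positivity
  rw [abs_mul, abs_of_nonneg hp]
  have h1 : Real.log (q * a / b) ≤ q * a / b := (Real.log_le_sub_one_of_pos hr).trans (by linarith)
  have h2 : -Real.log (q * a / b) ≤ b / (q * a) := by
    have := Real.one_sub_inv_le_log_of_pos hr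
    rw [inv_div] at this
    linarith
  have h3 : |Real.log (q * a / b)| ≤ q * b / a := by
    rw [abs_le']
    constructor
    · refine h1.trans ?_
      rw [div_le_div_iff₀ hb ha]
      nlinarith [mul_le_mul hab hab ha.le hb.le]
    · refine h2.trans ?_
      rw [div_le_div_iff₀ (by positivity) ha]
      nlinarith [mul_pos ha hb, mul_pos (mul_pos ha hb) hq0]
  calc p * |Real.log (q * a / b)| ≤ a * (q * b / a) :=
        mul_le_mul hpa h3 (abs_nonneg _) ha.le
    _ = q * b := by field_simp

/-- This is `log s ≥ 1 - 1/s` at `s = √(w/a)`: the termwise comparison of relative entropy with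
squared Hellinger distance. -/
theorem two_mul_sub_sqrt_le_mul_log {w a : ℝ} (hw : 0 ≤ w) (ha : 0 ≤ a) (h : a = 0 → w = 0) :
    2 * w - 2 * Real.sqrt (w * a) ≤ w * Real.log (w / a) := by
  rcases hw.eq_or_lt with rfl | hw'
  · simp
  have ha' : 0 < a := lt_of_le_of_ne ha fun h0 => hw'.ne' (h h0.symm)
  have hs : 0 < Real.sqrt (w / a) := Real.sqrt_pos.2 (by positivity)
  have h1 := Real.one_sub_inv_le_log_of_pos hs
  rw [Real.log_sqrt (by positivity)] at h1
  have h2 : w * (Real.sqrt (w / a))⁻¹ = Real.sqrt (w * a) := by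
    rw [Real.sqrt_div hw, Real.sqrt_mul hw, inv_div]
    have := Real.mul_self_sqrt hw
    field_simp
    rw [Real.sq_sqrt hw]
  nlinarith [mul_le_mul_of_nonneg_left h1 hw]

namespace DMC

variable {X : Type u}

/-- The sum over `y` of `(√W(y|x) - √W(y|x'))²` is `2 - 2 Z_{x,x'}`. -/
theorem prob_eq_of_bhatt₂_eq_one (W : DMC X) {x x' : X} (h : W.bhatt₂ x x' = 1) :
    W.prob x = W.prob x' := by
  have hs := ((W.hasSum_prob x).add (W.hasSum_prob x')).sub ((W.hasSum_bhatt₂ x x').mul_left 2)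
  have e : ∀ y, W.prob x y + W.prob x' y - 2 * Real.sqrt (W.prob x y * W.prob x' y) =
      (Real.sqrt (W.prob x y) - Real.sqrt (W.prob x' y)) ^ 2 := by
    intro y
    rw [sub_sq, Real.sq_sqrt (W.prob_nonneg x y), Real.sq_sqrt (W.prob_nonneg x' y),
      Real.sqrt_mul (W.prob_nonneg x y)]
    ring
  simp_rw [e, h] at hs
  norm_num at hs
  have h0 := (hasSum_zero_iff_of_nonneg fun y => sq_nonneg _).1 hs
  funext y
  have := congrFun h0 y
  rw [Pi.zero_apply, sq_eq_zero_iff, sub_eq_zero,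
    Real.sqrt_inj (W.prob_nonneg x y) (W.prob_nonneg x' y)] at this
  exact this

variable [Fintype X]

/-- The contribution of a single output to the symmetric capacity, as a function of the vector of
transition probabilities to this output. -/
noncomputable def capTerm (w : X → ℝ) : ℝ :=
  ∑ x, (1 / (Fintype.card X : ℝ)) * w x *
    Real.logb (Fintype.card X) (w x / ((1 / (Fintype.card X : ℝ)) * ∑ x', w x'))

theorem summable_symCap_term [Nontrivial X] (W : DMC X) (x : X) :
    Summable fun y => (1 / (Fintype.card X : ℝ)) * W.prob x y *
      Real.logb (Fintype.card X)
        (W.prob x y / ((1 / (Fintype.card X : ℝ)) * ∑ x', W.prob x' y)) := by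
  have hq : (1 : ℝ) < Fintype.card X := by exact_mod_cast Fintype.one_lt_card
  set q : ℝ := (Fintype.card X : ℝ)
  have hlog : 0 < Real.log q := Real.log_pos hq
  have hs : Summable fun y => ∑ x', W.prob x' y :=
    summable_sum fun x' _ => (W.hasSum_prob x').summable
  refine Summable.of_norm_bounded (g := fun y => (1 / q) * ((q * ∑ x', W.prob x' y) / Real.log q))
    ((hs.mul_left q).div_const _ |>.mul_left _) fun y => ?_
  have h := abs_mul_log_div_le hq.le (W.prob_nonneg x y) le_rfl
    (Finset.single_le_sum (f := fun x' => W.prob x' y) (fun x' _ => W.prob_nonneg x' y)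
      (Finset.mem_univ x))
  rw [Real.norm_eq_abs, Real.logb, mul_assoc, abs_mul, abs_of_pos (by positivity : 0 < 1 / q),
    ← mul_div_assoc, abs_div, abs_of_pos hlog]
  refine mul_le_mul_of_nonneg_left (div_le_div_of_nonneg_right ?_ hlog.le) (by positivity)
  rwa [one_div, div_mul_eq_div_div, div_inv_eq_mul, mul_comm (W.prob x y) q]

theorem hasSum_symCap [Nontrivial X] (W : DMC X) :
    HasSum (fun y => capTerm fun x => W.prob x y) W.symCap :=
  hasSum_sum fun x _ => (W.summable_symCap_term x).hasSum

section Pointwise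

variable {w : X → ℝ}

/-- Compare each `w x` with the average `a`: relative entropy dominates squared Hellinger distance
because the linear terms `a - w x` sum to zero. Then pass from `a` to the pair by `(r-s)² ≤ 2(r-c)²
+ 2(s-c)²`. The diagonal case `x = x'` is kept since it gives nonnegativity of the capacity. -/
theorem sq_sqrt_sub_sqrt_le_capTerm [Nontrivial X] (hw : ∀ x, 0 ≤ w x) (x x' : X) :
    w x + w x' - 2 * Real.sqrt (w x * w x') ≤
      2 * (Fintype.card X * Real.log (Fintype.card X)) * capTerm w := by
  have hq : (1 : ℝ) < Fintype.card X := by exact_mod_cast Fintype.one_lt_card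
  rw [capTerm]
  set q : ℝ := (Fintype.card X : ℝ) with hqdef
  have hlog : 0 < Real.log q := Real.log_pos hq
  set a : ℝ := 1 / q * ∑ x', w x' with hadef
  have hs0 : 0 ≤ ∑ x', w x' := Finset.sum_nonneg fun x _ => hw x
  have ha : 0 ≤ a := by positivity
  have h0 : ∀ x, a = 0 → w x = 0 := by
    intro x h
    have : ∑ x', w x' = 0 := by
      rcases mul_eq_zero.1 h with h | h
      · rw [one_div, inv_eq_zero] at h
        linarith
      · exact h
    exact (Finset.sum_eq_zero_iff_of_nonneg fun x _ => hw x).1 this x (Finset.mem_univ x)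
  have hsum : ∑ x : X, (Real.sqrt (w x) - Real.sqrt a) ^ 2 ≤
      q * Real.log q * ∑ x, 1 / q * w x * Real.logb q (w x / a) := by
    have e1 : q * Real.log q * ∑ x, 1 / q * w x * Real.logb q (w x / a) =
        ∑ x, w x * Real.log (w x / a) := by
      rw [Finset.mul_sum]
      refine Finset.sum_congr rfl fun x _ => ?_
      rw [Real.logb]
      field_simp
    have e2 : ∑ x : X, (Real.sqrt (w x) - Real.sqrt a) ^ 2 =
        ∑ x, (2 * w x - 2 * Real.sqrt (w x * a)) := by
      have e3 : ∀ x, (Real.sqrt (w x) - Real.sqrt a) ^ 2 =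
          (2 * w x - 2 * Real.sqrt (w x * a)) + (a - w x) := by
        intro x
        rw [sub_sq, Real.sq_sqrt (hw x), Real.sq_sqrt ha, Real.sqrt_mul (hw x)]
        ring
      have e4 : ∑ x : X, (a - w x) = 0 := by
        rw [Finset.sum_sub_distrib, Finset.sum_const, Finset.card_univ, nsmul_eq_mul, ← hqdef,
          hadef]
        field_simp
        ring
      rw [Finset.sum_congr rfl fun x _ => e3 x, Finset.sum_add_distrib, e4, add_zero]
    rw [e1, e2]
    exact Finset.sum_le_sum fun x _ => two_mul_sub_sqrt_le_mul_log (hw x) ha (h0 x)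
  have hx := fun x => Finset.single_le_sum
    (f := fun x => (Real.sqrt (w x) - Real.sqrt a) ^ 2) (fun x _ => sq_nonneg _)
    (Finset.mem_univ x)
  by_cases hxx : x = x'
  · subst hxx
    rw [Real.sqrt_mul_self (hw x)]
    have := (sq_nonneg _).trans ((hx x).trans hsum)
    linarith
  · classical
    have h2 : (Real.sqrt (w x) - Real.sqrt a) ^ 2 + (Real.sqrt (w x') - Real.sqrt a) ^ 2 ≤
        ∑ x : X, (Real.sqrt (w x) - Real.sqrt a) ^ 2 := by
      rw [← Finset.sum_pair (f := fun x => (Real.sqrt (w x) - Real.sqrt a) ^ 2) hxx]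
      exact Finset.sum_le_univ_sum_of_nonneg fun x => sq_nonneg _
    have h3 : w x + w x' - 2 * Real.sqrt (w x * w x') =
        (Real.sqrt (w x) - Real.sqrt (w x')) ^ 2 := by
      rw [sub_sq, Real.sq_sqrt (hw x), Real.sq_sqrt (hw x'), Real.sqrt_mul (hw x)]
      ring
    rw [h3]
    nlinarith [sq_nonneg (Real.sqrt (w x) + Real.sqrt (w x') - 2 * Real.sqrt a)]

/-- With `m = ∑ w`, the right-hand side is the unnormalised entropy `∑ w x log(m / w x)`. Its terms
are nonnegative, and `-log r ≥ 1 - r` bounds the one kept. -/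
theorem mul_one_sub_div_le_capTerm [Nontrivial X] (hw : ∀ x, 0 ≤ w x) (x : X) :
    w x * (1 - w x / ∑ x', w x') ≤ Fintype.card X * Real.log (Fintype.card X) *
      ((1 / (Fintype.card X : ℝ)) * ∑ x', w x' - capTerm w) := by
  have hq : (1 : ℝ) < Fintype.card X := by exact_mod_cast Fintype.one_lt_card
  rw [capTerm]
  set q : ℝ := (Fintype.card X : ℝ) with hqdef
  have hlog : 0 < Real.log q := Real.log_pos hq
  set m : ℝ := ∑ x', w x' with hm
  have hwm : ∀ x, w x ≤ m := fun x =>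
    Finset.single_le_sum (fun x _ => hw x) (Finset.mem_univ x)
  have e : q * Real.log q * (1 / q * m - ∑ x, 1 / q * w x * Real.logb q (w x / (1 / q * m))) =
      ∑ x, w x * (Real.log q - Real.log (w x / (1 / q * m))) := by
    have e0 : 1 / q * m = ∑ x, 1 / q * w x := Finset.mul_sum ..
    conv_lhs => enter [2, 1]; rw [e0]
    rw [← Finset.sum_sub_distrib, Finset.mul_sum]
    refine Finset.sum_congr rfl fun x _ => ?_
    rw [Real.logb]
    field_simp
  have hterm : ∀ x, w x * (1 - w x / m) ≤ w x * (Real.log q - Real.log (w x / (1 / q * m))) := by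
    intro x
    rcases (hw x).eq_or_lt with h | h
    · simp [← h]
    have hmp : 0 < m := h.trans_le (hwm x)
    refine mul_le_mul_of_nonneg_left ?_ (hw x)
    have h1 : Real.log (w x / (1 / q * m)) = Real.log q + Real.log (w x / m) := by
      rw [← Real.log_mul (by positivity) (by positivity)]
      congr 1
      field_simp
    have h2 := Real.log_le_sub_one_of_pos (show 0 < w x / m by positivity)
    rw [h1]
    linarith
  have hnn : ∀ x, 0 ≤ w x * (1 - w x / m) := fun x =>
    mul_nonneg (hw x) (sub_nonneg.2 (div_le_one_of_le₀ (hwm x) ((hw x).trans (hwm x))))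
  rw [e]
  refine (hterm x).trans (Finset.single_le_sum
    (f := fun x => w x * (Real.log q - Real.log (w x / (1 / q * m))))
    (fun x _ => (hnn x).trans (hterm x)) (Finset.mem_univ x))

/-- Since `w x' ≤ m - w x`, the entropy bound gives `w x * w x' ≤ m * T`. The weighted mean
inequality replaces `√(mT)` by an expression linear in `m` and `T`, which can be summed over
outputs; `ε` is chosen afterwards. -/
theorem sqrt_mul_le_capTerm [Nontrivial X] (hw : ∀ x, 0 ≤ w x) {x x' : X} (hx : x ≠ x')
    {ε : ℝ} (hε : 0 < ε) :
    Real.sqrt (w x * w x') ≤ ε * ∑ x', w x' + ε⁻¹ * (Fintype.card X * Real.log (Fintype.card X) *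
      ((1 / (Fintype.card X : ℝ)) * ∑ x', w x' - capTerm w)) := by
  classical
  have h := mul_one_sub_div_le_capTerm hw x
  set T := (Fintype.card X : ℝ) * Real.log (Fintype.card X) *
      ((1 / (Fintype.card X : ℝ)) * ∑ x', w x' - capTerm w)
  set m : ℝ := ∑ x', w x' with hm
  have hxm : w x + w x' ≤ m := by
    rw [← Finset.sum_pair hx]
    exact Finset.sum_le_univ_sum_of_nonneg hw
  have hm0 : 0 ≤ m := by linarith [hw x, hw x']
  rcases hm0.eq_or_lt with hz | hpos
  · have h0 : w x = 0 := by linarith [hw x, hw x']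
    rw [h0] at h ⊢
    simp only [zero_mul, Real.sqrt_zero] at h ⊢
    positivity
  have h1 : w x * w x' ≤ m * T := by
    have h2 : m * (w x * (1 - w x / m)) = w x * (m - w x) := by field_simp
    nlinarith [mul_le_mul_of_nonneg_left h hm0, mul_le_mul_of_nonneg_left
      (show w x' ≤ m - w x by linarith) (hw x)]
  have hT : 0 ≤ T := by
    have : 0 ≤ m * T := (mul_nonneg (hw x) (hw x')).trans h1
    exact nonneg_of_mul_nonneg_right this hpos
  rw [Real.sqrt_le_left (by positivity)]
  have : ε * ε⁻¹ = 1 := mul_inv_cancel₀ hε.ne'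
  nlinarith [sq_nonneg (ε * m - ε⁻¹ * T), mul_nonneg hm0 hT]

end Pointwise

theorem hasSum_sum_prob (W : DMC X) :
    HasSum (fun y => ∑ x, W.prob x y) (Fintype.card X) := by
  simpa using hasSum_sum (s := Finset.univ) fun (x : X) _ => W.hasSum_prob x

theorem one_sub_bhatt₂_le [Nontrivial X] (W : DMC X) (x x' : X) :
    1 - W.bhatt₂ x x' ≤ Fintype.card X * Real.log (Fintype.card X) * W.symCap := by
  have h := hasSum_le
    (fun y => sq_sqrt_sub_sqrt_le_capTerm (fun x => W.prob_nonneg x y) x x')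
    (((W.hasSum_prob x).add (W.hasSum_prob x')).sub ((W.hasSum_bhatt₂ x x').mul_left 2))
    (W.hasSum_symCap.mul_left _)
  linarith

theorem symCap_nonneg [Nontrivial X] (W : DMC X) : 0 ≤ W.symCap := by
  obtain ⟨x⟩ : Nonempty X := inferInstance
  have h := W.one_sub_bhatt₂_le x x
  have hq : (1 : ℝ) < Fintype.card X := by exact_mod_cast Fintype.one_lt_card
  have hlog : 0 < Real.log (Fintype.card X) := Real.log_pos hq
  rw [bhatt₂_self, sub_self] at h
  exact nonneg_of_mul_nonneg_right h (by positivity)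

theorem hasSum_deficit [Nontrivial X] (W : DMC X) :
    HasSum (fun y => (1 / (Fintype.card X : ℝ)) * ∑ x', W.prob x' y -
      capTerm fun x => W.prob x y) (1 - W.symCap) := by
  have h := (W.hasSum_sum_prob.mul_left (1 / (Fintype.card X : ℝ))).sub W.hasSum_symCap
  rwa [one_div_mul_cancel (by exact_mod_cast Fintype.card_ne_zero)] at h

theorem symCap_le_one [Nontrivial X] (W : DMC X) : W.symCap ≤ 1 := by
  obtain ⟨x⟩ : Nonempty X := inferInstance
  have hq : (1 : ℝ) < Fintype.card X := by exact_mod_cast Fintype.one_lt_card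
  have hlog : 0 < Real.log (Fintype.card X) := Real.log_pos hq
  refine sub_nonneg.1 (W.hasSum_deficit.nonneg fun y => ?_)
  have h := mul_one_sub_div_le_capTerm (fun x => W.prob_nonneg x y) x
  have hle : W.prob x y ≤ ∑ x', W.prob x' y :=
    Finset.single_le_sum (f := fun x => W.prob x y) (fun x _ => W.prob_nonneg x y)
      (Finset.mem_univ x)
  refine nonneg_of_mul_nonneg_right ((mul_nonneg (W.prob_nonneg x y) ?_).trans h) (by positivity)
  exact sub_nonneg.2 (div_le_one_of_le₀ hle ((W.prob_nonneg x y).trans hle))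

theorem abs_symCap_le_one [Nontrivial X] (W : DMC X) : |W.symCap| ≤ 1 :=
  abs_le.2 ⟨by linarith [W.symCap_nonneg], W.symCap_le_one⟩

theorem bhatt₂_le_of_symCap [Nontrivial X] (W : DMC X) {x x' : X} (hx : x ≠ x')
    {ε : ℝ} (hε : 0 < ε) :
    W.bhatt₂ x x' ≤ ε * Fintype.card X +
      ε⁻¹ * (Fintype.card X * Real.log (Fintype.card X) * (1 - W.symCap)) :=
  hasSum_le (fun y => sqrt_mul_le_capTerm (fun x => W.prob_nonneg x y) hx hε)
    (W.hasSum_bhatt₂ x x')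
    ((W.hasSum_sum_prob.mul_left ε).add ((W.hasSum_deficit.mul_left _).mul_left _))

theorem symCap_eq_zero_of_bhatt₂ (W : DMC X)
    (h : ∀ x x', x ≠ x' → W.bhatt₂ x x' = 1) : W.symCap = 0 := by
  have hp : ∀ x x', W.prob x = W.prob x' := by
    intro x x'
    by_cases hx : x = x'
    · rw [hx]
    · exact W.prob_eq_of_bhatt₂_eq_one (h x x' hx)
  rw [symCap]
  refine Finset.sum_eq_zero fun x _ => ?_
  refine (tsum_congr fun y => ?_).trans tsum_zero
  have hq : (Fintype.card X : ℝ) ≠ 0 := (card_pos_of_mem x).ne'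
  have : (1 / (Fintype.card X : ℝ)) * ∑ x', W.prob x' y = W.prob x y := by
    simp_rw [fun x' => hp x' x]
    simp only [Finset.sum_const, Finset.card_univ, nsmul_eq_mul]
    field_simp
  rw [this]
  by_cases h0 : W.prob x y = 0
  · simp [h0]
  · rw [div_self h0, Real.logb_one, mul_zero]

end DMC

/-! ### Conservation of the symmetric capacity -/

namespace DMC

variable {X : Type u} [Fintype X] [DecidableEq X]

/-- The unnormalised joint weight of the output `y` and the first `m` entries of the input `v`. -/
noncomputable def prefixSum (W : DMC X) {ℓ : ℕ} (g : (Fin ℓ → X) → (Fin ℓ → X)) (m : ℕ)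
    (y : Fin ℓ → W.Out) (v : Fin ℓ → X) : ℝ :=
  ∑ v' : Fin ℓ → X with ∀ j : Fin ℓ, j.val < m → v' j = v j, W.prodProb (g v') y

variable (W : DMC X) {ℓ : ℕ} (g : (Fin ℓ → X) → (Fin ℓ → X))

theorem prefixSum_zero (y : Fin ℓ → W.Out) (v : Fin ℓ → X) :
    W.prefixSum g 0 y v = ∑ v', W.prodProb (g v') y := by
  simp [prefixSum]

theorem prefixSum_self (y : Fin ℓ → W.Out) (v : Fin ℓ → X) :
    W.prefixSum g ℓ y v = W.prodProb (g v) y := by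
  have : (Finset.univ.filter fun v' : Fin ℓ → X => ∀ j : Fin ℓ, j.val < ℓ → v' j = v j) = {v} := by
    ext v'
    simp [funext_iff]
  rw [prefixSum, this, Finset.sum_singleton]

theorem prodProb_le_prefixSum (m : ℕ) (y : Fin ℓ → W.Out) (v : Fin ℓ → X) :
    W.prodProb (g v) y ≤ W.prefixSum g m y v :=
  Finset.single_le_sum (f := fun v' => W.prodProb (g v') y)
    (fun _ _ => W.prodProb_nonneg _ _) (by simp)

theorem prefixSum_succ_le (m : ℕ) (y : Fin ℓ → W.Out) (v : Fin ℓ → X) :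
    W.prefixSum g (m + 1) y v ≤ W.prefixSum g m y v := by
  refine Finset.sum_le_sum_of_subset_of_nonneg (fun v' h => ?_)
    fun _ _ _ => W.prodProb_nonneg _ _
  simp only [Finset.mem_filter, Finset.mem_univ, true_and] at h ⊢
  exact fun j hj => h j (by omega)

theorem sum_extensions_eq_prefixSum {i : Fin ℓ} {x : X} {u : {j : Fin ℓ // j < i} → X}
    {v : Fin ℓ → X} (hv : v ∈ extensions i x u) (y : Fin ℓ → W.Out) :
    ∑ v' ∈ extensions i x u, W.prodProb (g v') y = W.prefixSum g (i + 1) y v := by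
  rw [mem_extensions] at hv
  refine Finset.sum_congr ?_ fun _ _ => rfl
  ext v'
  simp only [mem_extensions, Finset.mem_filter, Finset.mem_univ, true_and]
  constructor
  · rintro ⟨h1, h2⟩ j hj
    rcases (Nat.lt_succ_iff.1 hj).eq_or_lt with h | h
    · rw [Fin.ext h, h2, hv.2]
    · exact (h1 ⟨j, h⟩).trans (hv.1 ⟨j, h⟩).symm
  · intro h
    exact ⟨fun j => (h j (Nat.lt_succ_of_lt j.2)).trans (hv.1 j),
      (h i (Nat.lt_succ_self _)).trans hv.2⟩

theorem sum_sum_extensions_eq_prefixSum {i : Fin ℓ} {x : X} {u : {j : Fin ℓ // j < i} → X}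
    {v : Fin ℓ → X} (hv : v ∈ extensions i x u) (y : Fin ℓ → W.Out) :
    ∑ x', ∑ v' ∈ extensions i x' u, W.prodProb (g v') y = W.prefixSum g i y v := by
  rw [mem_extensions] at hv
  rw [prefixSum, ← Finset.sum_fiberwise _ (fun v' : Fin ℓ → X => v' i)]
  refine Finset.sum_congr rfl fun x' _ => Finset.sum_congr ?_ fun _ _ => rfl
  ext v'
  simp only [mem_extensions, Finset.mem_filter, Finset.mem_univ, true_and]
  refine and_congr_left fun _ => ?_
  exact ⟨fun h j hj => (h ⟨j, hj⟩).trans (hv.1 ⟨j, hj⟩).symm,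
    fun h j => (h j j.2).trans (hv.1 j)⟩

/-- The contribution of the input `v` and the output `y` to the capacity of the `i`-th
subchannel. -/
noncomputable def chainTerm (i : ℕ) (y : Fin ℓ → W.Out) (v : Fin ℓ → X) : ℝ :=
  ((Fintype.card X : ℝ) ^ ℓ)⁻¹ * (W.prodProb (g v) y * Real.logb (Fintype.card X)
    (Fintype.card X * W.prefixSum g (i + 1) y v / W.prefixSum g i y v))

theorem summable_chainTerm [Nontrivial X] (i : ℕ) (v : Fin ℓ → X) :
    Summable fun y => W.chainTerm g i y v := by
  have hq : (1 : ℝ) < Fintype.card X := by exact_mod_cast Fintype.one_lt_card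
  have hlog : 0 < Real.log (Fintype.card X) := Real.log_pos hq
  refine Summable.mul_left _ ?_
  have hs : Summable fun y => W.prefixSum g i y v :=
    summable_sum fun v' _ => (W.hasSum_prodProb (g v')).summable
  refine Summable.of_norm_bounded ((hs.mul_left (Fintype.card X : ℝ)).div_const
    (Real.log (Fintype.card X))) fun y => ?_
  rw [Real.norm_eq_abs, Real.logb, ← mul_div_assoc, abs_div, abs_of_pos hlog]
  refine div_le_div_of_nonneg_right ?_ hlog.le
  exact abs_mul_log_div_le hq.le (W.prodProb_nonneg _ _) (W.prodProb_le_prefixSum g _ y v)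
    (W.prefixSum_succ_le g i y v)

/-- For `v` extending the prefix and the input `x`, the likelihood ratio of the subchannel is `q`
times a quotient of consecutive prefix sums. It is the same for all such `v`, so the capacity splits
over full inputs. -/
theorem symCap_sub_eq [Nontrivial X] (i : Fin ℓ) :
    (W.sub g i).symCap = ∑ v, ∑' y, W.chainTerm g i y v := by
  have hq : (0 : ℝ) < Fintype.card X := by exact_mod_cast Fintype.card_pos
  rw [symCap, ← Finset.sum_fiberwise _ (fun v : Fin ℓ → X => v i)]
  refine Finset.sum_congr rfl fun x _ => ?_
  refine (?_ : HasSum (fun p : (Fin ℓ → W.Out) × ({j : Fin ℓ // j < i} → X) =>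
    1 / (Fintype.card X : ℝ) * W.subProb g i x p * Real.logb (Fintype.card X)
      (W.subProb g i x p / (1 / (Fintype.card X : ℝ) * ∑ x', W.subProb g i x' p))) _).tsum_eq
  convert! hasSum_sum_extensions i x (fun y v => W.chainTerm g i y v) _
    fun v => (W.summable_chainTerm g i v).hasSum using 2 with p
  have hpow : (Fintype.card X : ℝ) ^ ℓ = Fintype.card X * (Fintype.card X : ℝ) ^ (ℓ - 1) := by
    rw [← pow_succ', Nat.sub_add_cancel (Nat.one_le_of_lt i.pos)]
  have hterm : ∀ v ∈ extensions i x p.2, W.chainTerm g i p.1 v =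
      1 / (Fintype.card X : ℝ) * ((Fintype.card X : ℝ) ^ (ℓ - 1))⁻¹ * W.prodProb (g v) p.1 *
        Real.logb (Fintype.card X)
          (W.subProb g i x p / (1 / (Fintype.card X : ℝ) * ∑ x', W.subProb g i x' p)) := by
    intro v hv
    have hc : ((Fintype.card X : ℝ) ^ (ℓ - 1))⁻¹ ≠ 0 := by positivity
    have e : W.subProb g i x p / (1 / (Fintype.card X : ℝ) * ∑ x', W.subProb g i x' p) =
        Fintype.card X * W.prefixSum g (i + 1) p.1 v / W.prefixSum g i p.1 v := by
      simp_rw [subProb_eq]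
      rw [← Finset.mul_sum, W.sum_extensions_eq_prefixSum g hv,
        W.sum_sum_extensions_eq_prefixSum g hv, mul_left_comm, mul_div_mul_left _ _ hc,
        one_div, div_mul_eq_div_div, div_inv_eq_mul, mul_comm (W.prefixSum g _ _ _)]
    rw [e, chainTerm, hpow, mul_inv]
    ring
  rw [Finset.sum_congr rfl hterm, ← Finset.sum_mul, ← Finset.mul_sum, subProb_eq]
  ring

/-- Chain rule for mutual information at a fixed pair `(y, v)`: the logarithms of prefix sums
telescope, and the prefix sum of length zero factorises over coordinates because `g` is a bijection.
-/
theorem sum_chainTerm [Nontrivial X] (hg : Function.Bijective g) (y : Fin ℓ → W.Out)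
    (v : Fin ℓ → X) :
    ∑ i : Fin ℓ, W.chainTerm g i y v = ((Fintype.card X : ℝ) ^ ℓ)⁻¹ *
      ∑ k, W.prodProb (g v) y * Real.logb (Fintype.card X)
        (W.prob (g v k) (y k) / (1 / (Fintype.card X : ℝ) * ∑ x, W.prob x (y k))) := by
  have hq : (1 : ℝ) < Fintype.card X := by exact_mod_cast Fintype.one_lt_card
  have hq0 : (Fintype.card X : ℝ) ≠ 0 := by linarith
  have hlogq : Real.logb (Fintype.card X) (Fintype.card X : ℝ) = 1 :=
    Real.logb_self_eq_one hq
  simp only [chainTerm]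
  rw [← Finset.mul_sum, ← Finset.mul_sum, ← Finset.mul_sum]
  congr 1
  -- A zero weight kills both sides; a positive weight makes every argument of a logarithm nonzero.
  rcases (W.prodProb_nonneg (g v) y).eq_or_lt with h0 | hpos
  · rw [← h0, zero_mul, zero_mul]
  congr 1
  have hA : ∀ m, W.prefixSum g m y v ≠ 0 := fun m =>
    (hpos.trans_le (W.prodProb_le_prefixSum g m y v)).ne'
  have hw : ∀ k, W.prob (g v k) (y k) ≠ 0 := fun k =>
    (Finset.prod_ne_zero_iff.1 hpos.ne') k (Finset.mem_univ k)
  have hS : ∀ k, ∑ x, W.prob x (y k) ≠ 0 := fun k =>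
    (lt_of_lt_of_le (lt_of_le_of_ne (W.prob_nonneg _ _) (hw k).symm)
      (Finset.single_le_sum (f := fun x => W.prob x (y k)) (fun x _ => W.prob_nonneg x _)
        (Finset.mem_univ (g v k)))).ne'
  have hL : ∀ i : Fin ℓ, Real.logb (Fintype.card X)
      (Fintype.card X * W.prefixSum g (i + 1) y v / W.prefixSum g i y v) =
      1 + (Real.logb (Fintype.card X) (W.prefixSum g (i + 1) y v) -
        Real.logb (Fintype.card X) (W.prefixSum g i y v)) := by
    intro i
    rw [Real.logb_div (mul_ne_zero hq0 (hA _)) (hA _), Real.logb_mul hq0 (hA _), hlogq]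
    ring
  have hR : ∀ k, Real.logb (Fintype.card X)
      (W.prob (g v k) (y k) / (1 / (Fintype.card X : ℝ) * ∑ x, W.prob x (y k))) =
      1 + (Real.logb (Fintype.card X) (W.prob (g v k) (y k)) -
        Real.logb (Fintype.card X) (∑ x, W.prob x (y k))) := by
    intro k
    rw [Real.logb_div (hw k) (mul_ne_zero (one_div_ne_zero hq0) (hS k)),
      Real.logb_mul (one_div_ne_zero hq0) (hS k), one_div, Real.logb_inv, hlogq]
    ring
  simp_rw [hL, hR]
  rw [Finset.sum_add_distrib, Finset.sum_add_distrib]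
  congr 1
  rw [Fin.sum_univ_eq_sum_range (fun i => Real.logb (Fintype.card X) (W.prefixSum g (i + 1) y v) -
    Real.logb (Fintype.card X) (W.prefixSum g i y v)),
    Finset.sum_range_sub fun i => Real.logb (Fintype.card X) (W.prefixSum g i y v), prefixSum_self,
    prefixSum_zero, Finset.sum_sub_distrib]
  have h1 : ∑ v', W.prodProb (g v') y = ∏ k, ∑ x, W.prob x (y k) := by
    rw [hg.sum_comp fun v' => W.prodProb v' y, Finset.prod_univ_sum, Fintype.piFinset_univ]
    rfl
  rw [h1, prodProb, Real.logb_prod _ _ fun k _ => hw k, Real.logb_prod _ _ fun k _ => hS k]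

theorem sum_apply_eq {ℓ : ℕ} (k : Fin ℓ) (c : X → ℝ) :
    ∑ v : Fin ℓ → X, c (v k) = (Fintype.card X : ℝ) ^ (ℓ - 1) * ∑ x, c x := by
  rw [← Finset.sum_fiberwise _ (fun v : Fin ℓ → X => v k), Finset.mul_sum]
  refine Finset.sum_congr rfl fun x _ => ?_
  rw [Finset.sum_congr rfl fun v hv => by rw [(Finset.mem_filter.1 hv).2], Finset.sum_const,
    card_filter_apply_eq, nsmul_eq_mul]
  push_cast
  rfl

/-- The average of the symmetric capacities of the subchannels induced by a bijective kernel is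
the symmetric capacity of the channel. -/
theorem sum_symCap_sub [Nontrivial X] (hg : Function.Bijective g) :
    ∑ i, (W.sub g i).symCap = ℓ * W.symCap := by
  have hq : (0 : ℝ) < Fintype.card X := by exact_mod_cast Fintype.card_pos
  let lam : X → W.Out → ℝ := fun x y => Real.logb (Fintype.card X)
    (W.prob x y / (1 / (Fintype.card X : ℝ) * ∑ x', W.prob x' y))
  let c : X → ℝ := fun x => ∑' y, W.prob x y * lam x y
  have hc : ∀ x, HasSum (fun y => W.prob x y * lam x y) (c x) := by
    intro x
    refine Summable.hasSum ?_
    have := (W.summable_symCap_term x).mul_left (Fintype.card X : ℝ)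
    refine this.congr fun y => ?_
    simp only [lam]
    field_simp
  have hcap : W.symCap = (1 / (Fintype.card X : ℝ)) * ∑ x, c x := by
    rw [symCap, Finset.mul_sum]
    refine Finset.sum_congr rfl fun x _ => ?_
    rw [← tsum_mul_left]
    exact tsum_congr fun y => mul_assoc _ _ _
  have hprod : ∀ (v : Fin ℓ → X) (k : Fin ℓ),
      HasSum (fun y => W.prodProb v y * lam (v k) (y k)) (c (v k)) := by
    intro v k
    -- Only the factor `k` carries the logarithm; the other factors sum to 1.
    have h := hasSum_pi_prod ℓ
      (fun j y => if j = k then W.prob (v j) y * lam (v j) y else W.prob (v j) y)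
      (fun j => if j = k then c (v j) else 1) fun j => by
        split_ifs
        · exact hc (v j)
        · exact W.hasSum_prob (v j)
    rw [Finset.prod_ite_eq' Finset.univ k, if_pos (Finset.mem_univ k)] at h
    convert! h using 2 with y
    have e : ∀ j, (if j = k then W.prob (v j) (y j) * lam (v j) (y j) else W.prob (v j) (y j)) =
        W.prob (v j) (y j) * if j = k then lam (v j) (y j) else 1 := by
      intro j
      split_ifs <;> simp
    rw [Finset.prod_congr rfl fun j _ => e j, Finset.prod_mul_distrib,
      Finset.prod_ite_eq' Finset.univ k, if_pos (Finset.mem_univ k)]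
    rfl
  have hv : ∀ v : Fin ℓ → X, ∑ i : Fin ℓ, ∑' y, W.chainTerm g i y v =
      ((Fintype.card X : ℝ) ^ ℓ)⁻¹ * ∑ k, c (g v k) := by
    intro v
    rw [← Summable.tsum_finsetSum fun (i : Fin ℓ) _ => W.summable_chainTerm g i v]
    simp_rw [W.sum_chainTerm g hg]
    exact ((hasSum_sum fun k _ => hprod (g v) k).mul_left _).tsum_eq
  simp_rw [symCap_sub_eq]
  rw [Finset.sum_comm, Finset.sum_congr rfl fun v _ => hv v, ← Finset.mul_sum,
    hg.sum_comp fun v => ∑ k, c (v k), Finset.sum_comm]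
  simp_rw [sum_apply_eq]
  rw [Finset.sum_const, Finset.card_univ, Fintype.card_fin, nsmul_eq_mul, hcap]
  rcases Nat.eq_zero_or_pos ℓ with h0 | hpos
  · subst h0
    simp
  have hpow : (Fintype.card X : ℝ) ^ ℓ = Fintype.card X * (Fintype.card X : ℝ) ^ (ℓ - 1) := by
    rw [← pow_succ', Nat.sub_add_cancel hpos]
  rw [hpow]
  field_simp

end DMC

/-! ### Extremal Bhattacharyya parameters -/

namespace DMC

section Extremal

variable {X : Type u}

/-- The maximum of `Z_{x,x'}(W)` over pairs of distinct inputs. -/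
noncomputable def bhattMax (W : DMC X) : ℝ :=
  ⨆ p : {p : X × X // p.1 ≠ p.2}, W.bhatt₂ p.1.1 p.1.2

instance nonempty_offDiag [Nontrivial X] : Nonempty {p : X × X // p.1 ≠ p.2} :=
  let ⟨x, x', h⟩ := exists_pair_ne X
  ⟨⟨(x, x'), h⟩⟩

theorem bhattMax_le [Nontrivial X] (W : DMC X) {z : ℝ} (h : ∀ x x', x ≠ x' → W.bhatt₂ x x' ≤ z) : W.bhattMax ≤ z :=
  ciSup_le fun p => h _ _ p.2

theorem le_bhattMin [Nonempty X] (W : DMC X) {z : ℝ} (h : ∀ x x', z ≤ W.bhatt₂ x x') : z ≤ W.bhattMin :=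
  le_ciInf fun _ => h _ _

theorem bhattMin_nonneg [Nonempty X] (W : DMC X) : 0 ≤ W.bhattMin :=
  W.le_bhattMin fun x x' => W.bhatt₂_nonneg x x'

theorem bhattMax_le_one [Nontrivial X] (W : DMC X) : W.bhattMax ≤ 1 :=
  W.bhattMax_le fun x x' _ => W.bhatt₂_le_one x x'

variable [Fintype X] (W : DMC X)

theorem bhatt₂_le_bhattMax {x x' : X} (h : x ≠ x') : W.bhatt₂ x x' ≤ W.bhattMax :=
  le_ciSup (f := fun p : {p : X × X // p.1 ≠ p.2} => W.bhatt₂ p.1.1 p.1.2)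
    (Set.finite_range _).bddAbove ⟨(x, x'), h⟩

theorem bhattMin_le_bhatt₂ (x x' : X) : W.bhattMin ≤ W.bhatt₂ x x' :=
  ciInf_le (f := fun p : X × X => W.bhatt₂ p.1 p.2) (Set.finite_range _).bddBelow (x, x')

theorem card_offDiag_cast [DecidableEq X] : ((Finset.univ.filter fun p : X × X => p.1 ≠ p.2).card : ℝ) =
    Fintype.card X * ((Fintype.card X : ℝ) - 1) := by
  have h : (Finset.univ.filter fun p : X × X => p.1 ≠ p.2) = (Finset.univ : Finset X).offDiag := by
    ext p
    simp
  rw [h, Finset.offDiag_card, Nat.cast_sub (Nat.le_mul_self _)]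
  push_cast
  rw [Finset.card_univ]
  ring

theorem bhatt_eq [DecidableEq X] (W : DMC X) : W.bhatt =
    (1 / ((Fintype.card X : ℝ) * ((Fintype.card X : ℝ) - 1))) *
      (∑ x, ∑ x', W.bhatt₂ x x' - Fintype.card X) := by
  rw [bhatt, ← Fintype.sum_prod_type' (f := fun x x' => W.bhatt₂ x x'),
    ← Finset.sum_filter_add_sum_filter_not Finset.univ fun p : X × X => p.1 ≠ p.2]
  have h : ∑ p : X × X with ¬p.1 ≠ p.2, W.bhatt₂ p.1 p.2 = Fintype.card X := by
    have e : (Finset.univ.filter fun p : X × X => ¬p.1 ≠ p.2) =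
        (Finset.univ : Finset X).diag := by
      ext p
      simp [Finset.mem_diag]
    rw [e, Finset.sum_diag]
    simp [bhatt₂_self]
  rw [h, add_sub_cancel_right]

variable [Nontrivial X]

theorem card_offDiag_pos : 0 < (Fintype.card X : ℝ) * ((Fintype.card X : ℝ) - 1) := by
  have hq : (1 : ℝ) < Fintype.card X := by exact_mod_cast Fintype.one_lt_card
  exact mul_pos (by linarith) (by linarith)

theorem bhattMax_nonneg : 0 ≤ W.bhattMax := by
  obtain ⟨x, x', h⟩ := exists_pair_ne X
  exact (W.bhatt₂_nonneg x x').trans (W.bhatt₂_le_bhattMax h)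

theorem bhattMin_le_bhattMax : W.bhattMin ≤ W.bhattMax := by
  obtain ⟨x, x', h⟩ := exists_pair_ne X
  exact (W.bhattMin_le_bhatt₂ x x').trans (W.bhatt₂_le_bhattMax h)

theorem bhattMax_le_of_symCap {ε : ℝ} (hε : 0 < ε) : W.bhattMax ≤ ε * Fintype.card X +
    ε⁻¹ * (Fintype.card X * Real.log (Fintype.card X) * (1 - W.symCap)) :=
  W.bhattMax_le fun _ _ h => W.bhatt₂_le_of_symCap h hε

theorem bhattMax_eq_zero_of_symCap_eq_one (hW : W.symCap = 1) : W.bhattMax = 0 := by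
  refine le_antisymm (le_of_forall_pos_le_add fun ε hε => ?_) W.bhattMax_nonneg
  have hq : (0 : ℝ) < Fintype.card X := by exact_mod_cast Fintype.card_pos
  have h := W.bhattMax_le_of_symCap (ε := ε / Fintype.card X) (by positivity)
  rw [hW, sub_self, mul_zero, mul_zero, add_zero, div_mul_cancel₀ _ hq.ne'] at h
  linarith

variable [DecidableEq X]

theorem bhatt_le_bhattMax : W.bhatt ≤ W.bhattMax := by
  rw [bhatt, one_div_mul_eq_div, div_le_iff₀ card_offDiag_pos, ← card_offDiag_cast, mul_comm,
    ← nsmul_eq_mul]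
  exact Finset.sum_le_card_nsmul _ _ _ fun p hp =>
    W.bhatt₂_le_bhattMax (Finset.mem_filter.1 hp).2

theorem le_bhatt {z : ℝ} (h : ∀ x x', x ≠ x' → z ≤ W.bhatt₂ x x') : z ≤ W.bhatt := by
  rw [bhatt, one_div_mul_eq_div, le_div_iff₀ card_offDiag_pos, ← card_offDiag_cast, mul_comm,
    ← nsmul_eq_mul]
  exact Finset.card_nsmul_le_sum _ _ _ fun p hp => h _ _ (Finset.mem_filter.1 hp).2

theorem one_sub_le_bhatt :
    1 - Fintype.card X * Real.log (Fintype.card X) * W.symCap ≤ W.bhatt :=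
  W.le_bhatt fun x x' _ => by linarith [W.one_sub_bhatt₂_le x x']

theorem bhattMin_le_bhatt : W.bhattMin ≤ W.bhatt :=
  W.le_bhatt fun x x' _ => W.bhattMin_le_bhatt₂ x x'

theorem symCap_eq_zero_of_bhatt (h : 1 ≤ W.bhatt) : W.symCap = 0 := by
  refine W.symCap_eq_zero_of_bhatt₂ fun x x' hx => ?_
  rw [bhatt, one_div_mul_eq_div, le_div_iff₀ card_offDiag_pos, one_mul, ← card_offDiag_cast] at h
  have h2 : ∑ p : X × X with p.1 ≠ p.2, (1 - W.bhatt₂ p.1 p.2) ≤ 0 := by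
    rw [Finset.sum_sub_distrib, Finset.sum_const, nsmul_eq_mul, mul_one]
    linarith
  have h3 := Finset.single_le_sum (f := fun p : X × X => 1 - W.bhatt₂ p.1 p.2)
    (s := Finset.univ.filter fun p : X × X => p.1 ≠ p.2)
    (fun p _ => sub_nonneg.2 (W.bhatt₂_le_one p.1 p.2))
    (Finset.mem_filter.2 ⟨Finset.mem_univ (x, x'), hx⟩)
  exact le_antisymm (W.bhatt₂_le_one x x') (by linarith)

end Extremal

end DMC

/-! ### Partial distances of an invertible matrix -/

section PartialDistance

variable {F : Type u} [Field F] {ℓ : ℕ} {G : Matrix (Fin ℓ) (Fin ℓ) F}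

theorem linKernel_injective (hG : IsUnit G) : Function.Injective (linKernel G) :=
  Matrix.vecMul_injective_iff_isUnit.2 hG

theorem linKernel_bijective [Finite F] (hG : IsUnit G) : Function.Bijective (linKernel G) :=
  Finite.injective_iff_bijective.1 (linKernel_injective hG)

theorem linKernel_zero : linKernel G 0 = 0 := Matrix.zero_vecMul G

theorem linKernel_add (v w : Fin ℓ → F) : linKernel G (v + w) = linKernel G v + linKernel G w :=
  Matrix.add_vecMul G v w

theorem linKernel_sub (v w : Fin ℓ → F) : linKernel G (v - w) = linKernel G v - linKernel G w :=
  Matrix.sub_vecMul G v w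

theorem linKernel_smul (a : F) (v : Fin ℓ → F) : linKernel G (a • v) = a • linKernel G v :=
  Matrix.smul_vecMul a v G

variable [DecidableEq F]

theorem exists_hammingNorm_eq_matrixDist (G : Matrix (Fin ℓ) (Fin ℓ) F) (i : Fin ℓ) :
    ∃ c : Fin ℓ → F, (∀ j < i, c j = 0) ∧ c i = 1 ∧
      hammingNorm (linKernel G c) = matrixDist G i := by
  have hne : {d | ∃ v w : Fin ℓ → F, (∀ j < i, v j = (0 : Fin ℓ → F) j) ∧
      (∀ j < i, w j = (0 : Fin ℓ → F) j) ∧ v i = 0 ∧ w i = 1 ∧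
      d = hammingDist (linKernel G v) (linKernel G w)}.Nonempty :=
    ⟨_, 0, Pi.single i 1, fun j _ => rfl, fun j hj => by simp [Pi.single_eq_of_ne hj.ne], rfl,
      by simp, rfl⟩
  obtain ⟨v, w, hv, hw, hvi, hwi, hd⟩ := Nat.sInf_mem hne
  refine ⟨w - v, fun j hj => ?_, ?_, ?_⟩
  · simp [hv j hj, hw j hj]
  · simp [hvi, hwi]
  · rw [matrixDist, partialDist, hd, hammingDist_eq_hammingNorm, linKernel_sub,
      neg_add_eq_sub]

theorem matrixDist_le_hammingNorm {i : Fin ℓ} {c : Fin ℓ → F} (h0 : ∀ j < i, c j = 0)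
    (h1 : c i ≠ 0) : matrixDist G i ≤ hammingNorm (linKernel G c) := by
  refine Nat.sInf_le ⟨0, (c i)⁻¹ • c, fun j _ => rfl, fun j hj => ?_, rfl, ?_, ?_⟩
  · simp [h0 j hj]
  · simp [h1]
  · rw [linKernel_smul, linKernel_zero, hammingDist_zero_left,
      hammingNorm_smul fun _ => IsSMulRegular.of_ne_zero (inv_ne_zero h1)]

theorem matrixDist_le_hammingDist {i : Fin ℓ} {v w : Fin ℓ → F} (h0 : ∀ j < i, v j = w j)
    (h1 : v i ≠ w i) : matrixDist G i ≤ hammingDist (linKernel G v) (linKernel G w) := by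
  rw [hammingDist_eq_hammingNorm, neg_add_eq_sub, ← linKernel_sub]
  exact matrixDist_le_hammingNorm (fun j hj => by simp [h0 j hj])
    (by simpa [sub_ne_zero] using h1.symm)

theorem matrixDist_pos (hG : IsUnit G) (i : Fin ℓ) : 0 < matrixDist G i := by
  obtain ⟨c, -, h1, hd⟩ := exists_hammingNorm_eq_matrixDist G i
  rw [← hd, hammingNorm_pos_iff]
  intro h
  have := linKernel_injective hG (h.trans linKernel_zero.symm)
  simp [this] at h1

/-- The preimage of a unit vector has an image of weight one; the index is that of its first nonzero
entry. -/
theorem exists_matrixDist_eq_one (hℓ : 0 < ℓ) (hG : IsUnit G) : ∃ i, matrixDist G i = 1 := by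
  obtain ⟨c, hc⟩ := Matrix.vecMul_surjective_iff_isUnit.2 hG (Pi.single ⟨0, hℓ⟩ 1)
  have hc0 : ∃ n, ∃ h : n < ℓ, c ⟨n, h⟩ ≠ 0 := by
    by_contra! h
    have : c = 0 := funext fun j => h j j.2
    have h1 := congrFun hc ⟨0, hℓ⟩
    simp [this] at h1
  classical
  obtain ⟨hlt, hne⟩ := Nat.find_spec hc0
  refine ⟨⟨Nat.find hc0, hlt⟩, le_antisymm ?_ (matrixDist_pos hG _)⟩
  refine (matrixDist_le_hammingNorm (G := G) (c := c) (fun j hj => ?_) hne).trans ?_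
  · by_contra h
    exact Nat.find_min hc0 hj ⟨j.2, h⟩
  · have : linKernel G c = Pi.single ⟨0, hℓ⟩ 1 := hc
    rw [this, hammingNorm]
    refine Finset.card_le_one.2 fun a ha b hb => ?_
    simp only [Finset.mem_filter, Finset.mem_univ, true_and, Pi.single_apply, ne_eq,
      ite_eq_right_iff, one_ne_zero, imp_false, not_not] at ha hb
    rw [ha, hb]

end PartialDistance

/-! ### One polarization step for the Bhattacharyya parameters -/

namespace DMC

section General

variable {X : Type u} [Fintype X] [DecidableEq X] (W : DMC X) {ℓ : ℕ}

theorem sqrt_subProb_mul (g : (Fin ℓ → X) → (Fin ℓ → X)) (i : Fin ℓ) (x x' : X)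
    (p : (Fin ℓ → W.Out) × ({j : Fin ℓ // j < i} → X)) :
    Real.sqrt (W.subProb g i x p * W.subProb g i x' p) =
      ((Fintype.card X : ℝ) ^ (ℓ - 1))⁻¹ *
        Real.sqrt ((∑ v ∈ extensions i x p.2, W.prodProb (g v) p.1) *
          ∑ v ∈ extensions i x' p.2, W.prodProb (g v) p.1) := by
  rw [subProb_eq, subProb_eq, mul_mul_mul_comm, Real.sqrt_mul (by positivity),
    Real.sqrt_mul_self (by positivity)]

theorem hasSum_bhatt₂_sub (g : (Fin ℓ → X) → (Fin ℓ → X)) (i : Fin ℓ) (x x' : X) :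
    HasSum (fun p : (Fin ℓ → W.Out) × ({j : Fin ℓ // j < i} → X) =>
      ((Fintype.card X : ℝ) ^ (ℓ - 1))⁻¹ *
        Real.sqrt ((∑ v ∈ extensions i x p.2, W.prodProb (g v) p.1) *
          ∑ v ∈ extensions i x' p.2, W.prodProb (g v) p.1)) ((W.sub g i).bhatt₂ x x') := by
  simp_rw [← W.sqrt_subProb_mul g i x x']
  exact (W.sub g i).hasSum_bhatt₂ x x'

theorem sqrt_add_le_add_sqrt {a b : ℝ} (ha : 0 ≤ a) (hb : 0 ≤ b) :
    Real.sqrt (a + b) ≤ Real.sqrt a + Real.sqrt b := by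
  rw [Real.sqrt_le_left (by positivity), add_sq, Real.sq_sqrt ha, Real.sq_sqrt hb]
  have : 0 ≤ 2 * Real.sqrt a * Real.sqrt b := by positivity
  linarith

theorem sqrt_sum_le_sum_sqrt {ι : Type*} (s : Finset ι) (f : ι → ℝ) (hf : ∀ i, 0 ≤ f i) :
    Real.sqrt (∑ i ∈ s, f i) ≤ ∑ i ∈ s, Real.sqrt (f i) := by
  classical
  induction s using Finset.induction_on with
  | empty => simp
  | insert a s ha ih =>
    rw [Finset.sum_insert ha, Finset.sum_insert ha]
    exact (sqrt_add_le_add_sqrt (hf a) (Finset.sum_nonneg fun i _ => hf i)).trans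
      (add_le_add_right ih _)

theorem pow_card_inv_mul_sum_filter [Nonempty X] (i : Fin ℓ) (x : X) (r : ℝ) :
    ∑ v : Fin ℓ → X with v i = x, ((Fintype.card X : ℝ) ^ (ℓ - 1))⁻¹ * r = r := by
  have hq : (0 : ℝ) < Fintype.card X := by exact_mod_cast Fintype.card_pos
  rw [Finset.sum_const, card_filter_apply_eq, nsmul_eq_mul]
  push_cast
  field_simp

end General

variable {F : Type u} [Field F] [Fintype F] [DecidableEq F] (W : DMC F) {ℓ : ℕ}
  (G : Matrix (Fin ℓ) (Fin ℓ) F)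

/-- Subadditivity of the square root reduces the sum to pairs of inputs with a common prefix. The
images of a pair differ in at least `D^{[i]}` places, each contributing a factor at most `Z_max`;
`q^ℓ` is a crude count of partners. -/
theorem bhattMax_sub_le (i : Fin ℓ) :
    (W.sub (linKernel G) i).bhattMax ≤
      (Fintype.card F : ℝ) ^ ℓ * W.bhattMax ^ matrixDist G i := by
  have hq : (0 : ℝ) < Fintype.card F := by exact_mod_cast Fintype.card_pos
  set z := W.bhattMax
  have hz0 : 0 ≤ z := W.bhattMax_nonneg
  refine bhattMax_le _ fun x x' hx => ?_
  -- The partners are described through the prefix of `v`, so that the summand depends on `(y, v)`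
  -- alone, as `hasSum_sum_extensions` requires.
  let T : (Fin ℓ → F) → Finset (Fin ℓ → F) := fun v => extensions i x' fun j => v j
  have hS := hasSum_sum_extensions (α := W.Out) i x
    (fun y v => ((Fintype.card F : ℝ) ^ (ℓ - 1))⁻¹ * ∑ w ∈ T v,
      Real.sqrt (W.prodProb (linKernel G v) y * W.prodProb (linKernel G w) y)) _
    fun v => (hasSum_sum fun w _ => W.hasSum_sqrt_prodProb _ _).mul_left _
  have hle := hasSum_le (fun p => ?_) (W.hasSum_bhatt₂_sub (linKernel G) i x x') hS
  · refine hle.trans ?_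
    rw [← pow_card_inv_mul_sum_filter i x ((Fintype.card F : ℝ) ^ ℓ * z ^ matrixDist G i)]
    refine Finset.sum_le_sum fun v hv => mul_le_mul_of_nonneg_left ?_ (by positivity)
    have hvx : v i = x := (Finset.mem_filter.1 hv).2
    have h1 : ∀ w ∈ T v, ∏ j, W.bhatt₂ (linKernel G v j) (linKernel G w j) ≤
        z ^ matrixDist G i := by
      intro w hw
      rw [mem_extensions] at hw
      refine (W.prod_bhatt₂_le (fun x x' h => W.bhatt₂_le_bhattMax h) _ _).trans ?_
      refine pow_le_pow_of_le_one hz0 W.bhattMax_le_one (matrixDist_le_hammingDist ?_ ?_)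
      · exact fun j hj => (hw.1 ⟨j, hj⟩).symm
      · rw [hvx, hw.2]
        exact hx
    refine (Finset.sum_le_card_nsmul _ _ _ h1).trans ?_
    rw [nsmul_eq_mul]
    refine mul_le_mul_of_nonneg_right ?_ (by positivity)
    have := Finset.card_le_univ (T v)
    rw [Fintype.card_pi_const] at this
    exact_mod_cast this
  · rw [← Finset.mul_sum]
    refine mul_le_mul_of_nonneg_left ?_ (by positivity)
    have hT : ∀ v ∈ extensions i x p.2, ∑ w ∈ T v, Real.sqrt
        (W.prodProb (linKernel G v) p.1 * W.prodProb (linKernel G w) p.1) =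
        ∑ w ∈ extensions i x' p.2, Real.sqrt
          (W.prodProb (linKernel G v) p.1 * W.prodProb (linKernel G w) p.1) := by
      intro v hv
      rw [mem_extensions] at hv
      simp only [T]
      rw [funext hv.1]
    rw [Finset.sum_congr rfl hT, Finset.sum_mul_sum]
    refine (sqrt_sum_le_sum_sqrt _ _ fun v => Finset.sum_nonneg fun w _ =>
      mul_nonneg (W.prodProb_nonneg _ _) (W.prodProb_nonneg _ _)).trans ?_
    exact Finset.sum_le_sum fun v _ => sqrt_sum_le_sum_sqrt _ _ fun w =>
      mul_nonneg (W.prodProb_nonneg _ _) (W.prodProb_nonneg _ _)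

/-- Translation by a multiple of `c` keeps the prefix and changes the `i`-th entry from `x` to `x'`.
With `c` of minimal image weight, this is the pairing used in Cauchy–Schwarz. -/
theorem sum_extensions_shift {M : Type*} [AddCommMonoid M] {i : Fin ℓ} {c : Fin ℓ → F}
    (hc0 : ∀ j < i, c j = 0) (hc1 : c i = 1) (x x' : F) (u : {j : Fin ℓ // j < i} → F)
    (f : (Fin ℓ → F) → M) :
    ∑ v ∈ extensions i x' u, f v = ∑ v ∈ extensions i x u, f (v + (x' - x) • c) := by
  symm
  refine Finset.sum_nbij' (fun v => v + (x' - x) • c) (fun v => v - (x' - x) • c) ?_ ?_ ?_ ?_ ?_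
  · intro v hv
    rw [mem_extensions] at hv ⊢
    exact ⟨fun j => by simp [hc0 j j.2, hv.1 j], by simp [hc1, hv.2]⟩
  · intro v hv
    rw [mem_extensions] at hv ⊢
    exact ⟨fun j => by simp [hc0 j j.2, hv.1 j], by simp [hc1, hv.2]⟩
  · intro v _
    simp
  · intro v _
    simp
  · intro v _
    rfl

theorem hasSum_shift (i : Fin ℓ) (c : Fin ℓ → F) (x x' : F) :
    HasSum (fun p : (Fin ℓ → W.Out) × ({j : Fin ℓ // j < i} → F) =>
      ∑ v ∈ extensions i x p.2, ((Fintype.card F : ℝ) ^ (ℓ - 1))⁻¹ *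
        Real.sqrt (W.prodProb (linKernel G v) p.1 *
          W.prodProb (linKernel G (v + (x' - x) • c)) p.1))
      (∑ v : Fin ℓ → F with v i = x, ((Fintype.card F : ℝ) ^ (ℓ - 1))⁻¹ *
        ∏ j, W.bhatt₂ (linKernel G v j) (linKernel G (v + (x' - x) • c) j)) :=
  hasSum_sum_extensions (α := W.Out) i x (fun y v => ((Fintype.card F : ℝ) ^ (ℓ - 1))⁻¹ *
    Real.sqrt (W.prodProb (linKernel G v) y * W.prodProb (linKernel G (v + (x' - x) • c)) y)) _
    fun _ => (W.hasSum_sqrt_prodProb _ _).mul_left _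

/-- Cauchy–Schwarz bounds the root of the product of the two sums below by the sum over pairs `v`,
`v + (x' - x) • c`, whose images differ in at most `D^{[i]}` places. -/
theorem pow_bhattMin_le (i : Fin ℓ) :
    W.bhattMin ^ matrixDist G i ≤ (W.sub (linKernel G) i).bhattMin := by
  have hq : (0 : ℝ) < Fintype.card F := by exact_mod_cast Fintype.card_pos
  obtain ⟨c, hc0, hc1, hcd⟩ := exists_hammingNorm_eq_matrixDist G i
  refine le_bhattMin _ fun x x' => ?_
  have hle := hasSum_le (fun p => ?_) (W.hasSum_shift G i c x x')
    (W.hasSum_bhatt₂_sub (linKernel G) i x x')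
  · refine le_trans ?_ hle
    rw [← pow_card_inv_mul_sum_filter i x (W.bhattMin ^ matrixDist G i)]
    refine Finset.sum_le_sum fun _ _ => mul_le_mul_of_nonneg_left ?_ (by positivity)
    refine le_trans ?_ (W.le_prod_bhatt₂ W.bhattMin_nonneg W.bhattMin_le_bhatt₂ _ _)
    refine pow_le_pow_of_le_one W.bhattMin_nonneg
      (W.bhattMin_le_bhattMax.trans W.bhattMax_le_one) ?_
    rw [hammingDist_eq_hammingNorm, linKernel_add, neg_add_cancel_left, linKernel_smul, ← hcd]
    exact hammingNorm_smul_le_hammingNorm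
  · rw [← Finset.mul_sum, sum_extensions_shift hc0 hc1 x x']
    refine mul_le_mul_of_nonneg_left ?_ (by positivity)
    have h := Real.sum_sqrt_mul_sqrt_le (extensions i x p.2)
      (f := fun v => W.prodProb (linKernel G v) p.1)
      (g := fun v => W.prodProb (linKernel G (v + (x' - x) • c)) p.1)
      (fun v => W.prodProb_nonneg _ _) (fun v => W.prodProb_nonneg _ _)
    rw [← Real.sqrt_mul (Finset.sum_nonneg fun v _ => W.prodProb_nonneg _ _)] at h
    refine le_trans (le_of_eq ?_) h
    exact Finset.sum_congr rfl fun v _ => Real.sqrt_mul (W.prodProb_nonneg _ _) _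

end DMC

/-! ### Matrices all of whose partial distances are one -/

section UnitDistances

variable {F : Type u} [Field F] [DecidableEq F] {ℓ : ℕ} {G : Matrix (Fin ℓ) (Fin ℓ) F}

theorem exists_single_of_matrixDist_eq_one {i : Fin ℓ} (h : matrixDist G i = 1) :
    ∃ (c : Fin ℓ → F) (k : Fin ℓ) (a : F), (∀ j < i, c j = 0) ∧ c i = 1 ∧ a ≠ 0 ∧
      linKernel G c = Pi.single k a := by
  obtain ⟨c, hc0, hc1, hcd⟩ := exists_hammingNorm_eq_matrixDist G i
  rw [h, hammingNorm, Finset.card_eq_one] at hcd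
  obtain ⟨k, hk⟩ := hcd
  have hmem : ∀ j, linKernel G c j ≠ 0 ↔ j = k := by
    intro j
    have := Finset.ext_iff.1 hk j
    simpa using this
  refine ⟨c, k, linKernel G c k, hc0, hc1, (hmem k).2 rfl, ?_⟩
  funext j
  by_cases hj : j = k
  · subst hj
    simp
  · rw [Pi.single_eq_of_ne hj]
    by_contra h0
    exact hj ((hmem j).1 h0)

/-- The vectors of `exists_single_of_matrixDist_eq_one` form a triangular basis mapped to coordinate
axes. Here `w` lies in the span of those with index above `i`, and their axes all differ from the
`k`-th. -/
theorem linKernel_apply_eq_zero (hG : IsUnit G) (hD : ∀ i, matrixDist G i = 1) {i k : Fin ℓ}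
    {c : Fin ℓ → F} {a : F} (hc1 : c i = 1) (hck : linKernel G c = Pi.single k a)
    {w : Fin ℓ → F} (hw : ∀ j ≤ i, w j = 0) : linKernel G w k = 0 := by
  -- Here `n` counts the trailing coordinates allowed to be nonzero; all of them lie beyond `i`.
  suffices H : ∀ n, n + i < ℓ → ∀ w : Fin ℓ → F, (∀ j : Fin ℓ, j.val + n < ℓ → w j = 0) →
      linKernel G w k = 0 by
    refine H (ℓ - i - 1) (by omega) w fun j hj => hw j ?_
    rw [Fin.le_def]
    omega
  intro n
  induction n with
  | zero =>
    intro _ w hw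
    have : w = 0 := funext fun j => hw j j.2
    rw [this, linKernel_zero]
    rfl
  | succ n ih =>
    intro hn w hw
    obtain ⟨c', k', a', hc0', hc1', ha', hck'⟩ :=
      exists_single_of_matrixDist_eq_one (hD ⟨ℓ - (n + 1), by omega⟩)
    have hw' := ih (by omega) (w - w ⟨ℓ - (n + 1), by omega⟩ • c') (fun j hj => by
      rcases Nat.lt_or_ge (j.val + (n + 1)) ℓ with h | h
      · have h1 := hc0' j (by rw [Fin.lt_def]; simp only; omega)
        simp [hw j h, h1]
      · have : j = ⟨ℓ - (n + 1), by omega⟩ := Fin.ext (by simp only; omega)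
        rw [this]
        simp [hc1'])
    rw [linKernel_sub, linKernel_smul, hck', Pi.sub_apply, sub_eq_zero] at hw'
    rw [hw', Pi.smul_apply]
    -- A shared axis would make `c` a multiple of `c'`, by injectivity, whereas `c'` vanishes at `i`
    -- and `c` does not.
    by_cases hk : k = k'
    · exfalso
      subst hk
      have h1 : linKernel G c = linKernel G ((a / a') • c') := by
        rw [linKernel_smul, hck, hck', ← Pi.single_smul, smul_eq_mul, div_mul_cancel₀ _ ha']
      have h2 := congrFun (linKernel_injective hG h1) i
      rw [hc1, Pi.smul_apply, hc0' i (by rw [Fin.lt_def]; simp only; omega), smul_zero] at h2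
      exact one_ne_zero h2
    · rw [Pi.single_eq_of_ne hk, smul_zero]

end UnitDistances

namespace DMC

variable {F : Type u} [Field F] [Fintype F] [DecidableEq F] (W : DMC F) {ℓ : ℕ}
  {G : Matrix (Fin ℓ) (Fin ℓ) F}

/-- The prefix and `u_i` determine the `k`-th codeword coordinate, and the shift by `δ • c` alters
that coordinate only. The paired weights are therefore proportional, with a ratio independent of
`v`, and Cauchy–Schwarz is an equality. -/
theorem bhatt₂_sub_eq (hG : IsUnit G) (hD : ∀ i, matrixDist G i = 1) (i : Fin ℓ) :
    ∃ (k : Fin ℓ) (a : F), a ≠ 0 ∧ ∀ x δ, (W.sub (linKernel G) i).bhatt₂ x (x + δ) =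
      ∑ v : Fin ℓ → F with v i = x, ((Fintype.card F : ℝ) ^ (ℓ - 1))⁻¹ *
        W.bhatt₂ (linKernel G v k) (linKernel G v k + δ * a) := by
  obtain ⟨c, k, a, hc0, hc1, ha, hck⟩ := exists_single_of_matrixDist_eq_one (hD i)
  refine ⟨k, a, ha, fun x δ => ?_⟩
  have hadd : ∀ v, linKernel G (v + δ • c) = linKernel G v + Pi.single k (δ * a) := by
    intro v
    rw [linKernel_add, linKernel_smul, hck, ← Pi.single_smul, smul_eq_mul]
  have h1 := W.hasSum_bhatt₂_sub (linKernel G) i x (x + δ)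
  have h2 := W.hasSum_shift G i c x (x + δ)
  simp only [add_sub_cancel_left, hadd] at h2
  have hprod : ∀ v : Fin ℓ → F, ∏ j, W.bhatt₂ (linKernel G v j)
      ((linKernel G v + (Pi.single k (δ * a) : Fin ℓ → F)) j) =
      W.bhatt₂ (linKernel G v k) (linKernel G v k + δ * a) := by
    intro v
    rw [Finset.prod_eq_single k]
    · simp
    · intro j _ hj
      simp [Pi.single_eq_of_ne hj, bhatt₂_self]
    · simp
  simp only [hprod] at h2
  refine h1.unique (h2.congr_fun ?_)
  rintro ⟨y, u⟩
  simp only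
  rw [← Finset.mul_sum]
  congr 1
  rw [sum_extensions_shift hc0 hc1 x (x + δ)]
  simp only [add_sub_cancel_left, hadd]
  rcases (extensions i x u).eq_empty_or_nonempty with he | ⟨v₀, hv₀⟩
  · simp [he]
  set s := linKernel G v₀ k
  have hs : ∀ v ∈ extensions i x u, linKernel G v k = s := by
    intro v hv
    rw [mem_extensions] at hv hv₀
    have := linKernel_apply_eq_zero hG hD hc1 hck (w := v - v₀) fun j hj => by
      rcases hj.eq_or_lt with h | h
      · rw [h, Pi.sub_apply, hv.2, hv₀.2, sub_self]
      · rw [Pi.sub_apply, hv.1 ⟨j, h⟩, hv₀.1 ⟨j, h⟩, sub_self]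
    rwa [linKernel_sub, Pi.sub_apply, sub_eq_zero] at this
  let R : (Fin ℓ → F) → ℝ := fun v => ∏ j ∈ Finset.univ.erase k, W.prob (linKernel G v j) (y j)
  have hR : ∀ v, 0 ≤ R v := fun v => Finset.prod_nonneg fun j _ => W.prob_nonneg _ _
  have hα : ∀ v ∈ extensions i x u, W.prodProb (linKernel G v) y = R v * W.prob s (y k) := by
    intro v hv
    rw [prodProb, ← Finset.prod_erase_mul _ _ (Finset.mem_univ k), hs v hv]
  have hβ : ∀ v ∈ extensions i x u, W.prodProb (linKernel G v + Pi.single k (δ * a)) y =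
      R v * W.prob (s + δ * a) (y k) := by
    intro v hv
    rw [prodProb, ← Finset.prod_erase_mul _ _ (Finset.mem_univ k), Pi.add_apply,
      Pi.single_eq_same, hs v hv]
    congr 1
    refine Finset.prod_congr rfl fun j hj => ?_
    rw [Pi.add_apply, Pi.single_eq_of_ne (Finset.ne_of_mem_erase hj), add_zero]
  rw [Finset.sum_congr rfl hα, Finset.sum_congr rfl hβ, ← Finset.sum_mul, ← Finset.sum_mul,
    mul_mul_mul_comm, Real.sqrt_mul (mul_self_nonneg _),
    Real.sqrt_mul_self (Finset.sum_nonneg fun v _ => hR v), Finset.sum_mul]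
  refine Finset.sum_congr rfl fun v hv => ?_
  rw [hα v hv, hβ v hv, mul_mul_mul_comm, Real.sqrt_mul (mul_self_nonneg _),
    Real.sqrt_mul_self (hR v)]

/-- Summing over all `x` makes the `k`-th codeword coordinate uniform, since the kernel is
bijective, and `δ ↦ δ * a` permutes the differences. -/
theorem bhatt_sub_eq (hG : IsUnit G) (hD : ∀ i, matrixDist G i = 1) (i : Fin ℓ) :
    (W.sub (linKernel G) i).bhatt = W.bhatt := by
  have hq : (0 : ℝ) < Fintype.card F := by exact_mod_cast Fintype.card_pos
  obtain ⟨k, a, ha, h⟩ := W.bhatt₂_sub_eq hG hD i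
  rw [bhatt_eq, bhatt_eq]
  congr 2
  have e1 : ∀ V : DMC F, ∑ x, ∑ x', V.bhatt₂ x x' = ∑ δ, ∑ x, V.bhatt₂ x (x + δ) := by
    intro V
    rw [Finset.sum_comm (γ := F) (f := fun δ x => V.bhatt₂ x (x + δ))]
    refine Finset.sum_congr rfl fun x _ => ?_
    exact (Equiv.sum_comp (Equiv.addLeft x) fun x' => V.bhatt₂ x x').symm
  rw [e1, e1, ← Equiv.sum_comp (Equiv.mulRight₀ a ha) fun δ => ∑ x, W.bhatt₂ x (x + δ)]
  refine Finset.sum_congr rfl fun δ _ => ?_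
  simp_rw [h, ← Finset.mul_sum]
  rw [Finset.sum_fiberwise Finset.univ (fun v : Fin ℓ → F => v i)
    fun v => W.bhatt₂ (linKernel G v k) (linKernel G v k + δ * a),
    (linKernel_bijective hG).sum_comp fun v => W.bhatt₂ (v k) (v k + δ * a),
    sum_apply_eq k fun s => W.bhatt₂ s (s + δ * a), ← mul_assoc,
    inv_mul_cancel₀ (by positivity), one_mul]
  rfl

end DMC

/-! ### Pathwise estimates -/

/-- A bootstrap: divergence of `y` makes the errors small, hence `y` grows linearly, hence the
errors are geometrically small and their sum is finite. -/
theorem exists_sub_le_of_recursion {y S : ℕ → ℝ} {E K : ℝ} (hE : 0 < E) (hK : 0 ≤ K)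
    (hy : Tendsto y atTop atTop) (hS : Tendsto (fun n : ℕ => S n / n) atTop (𝓝 E))
    (hrec : ∀ᶠ n in atTop, y n + (S (n + 1) - S n) - K * Real.exp (-y n) ≤ y (n + 1)) :
    ∃ R, ∀ᶠ n in atTop, S n - R ≤ y n := by
  have htel : ∀ (e : ℕ → ℝ) (N : ℕ),
      (∀ n ≥ N, y n + (S (n + 1) - S n) - e n ≤ y (n + 1)) →
      ∀ n ≥ N, y N - S N - ∑ k ∈ Finset.Ico N n, e k ≤ y n - S n := by
    intro e N h n hn
    induction n, hn using Nat.le_induction with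
    | base => simp
    | succ n hn ih =>
      rw [Finset.sum_Ico_succ_top hn]
      linarith [h n hn]
  have h0 : Tendsto (fun n => K * Real.exp (-y n)) atTop (𝓝 0) := by
    simpa using (Real.tendsto_exp_neg_atTop_nhds_zero.comp hy).const_mul K
  obtain ⟨N, hN⟩ := eventually_atTop.1
    ((h0.eventually_lt_const (show (0 : ℝ) < E / 4 by positivity)).and hrec)
  -- Errors of `E/4` against a drift of at least `3E/4` leave slope `E/2`; another `E/4` absorbs the
  -- initial value.
  have h1 := htel (fun _ => E / 4) N fun n hn => by linarith [(hN n hn).1, (hN n hn).2]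
  have hlin : ∀ᶠ n : ℕ in atTop, E / 4 * n ≤ y n := by
    have hS' := hS.eventually_const_lt (show 3 * E / 4 < E by linarith)
    have hbig := tendsto_natCast_atTop_atTop (R := ℝ) |>.eventually_ge_atTop
      (-(y N - S N) / (E / 4))
    filter_upwards [hS', hbig, eventually_ge_atTop N, eventually_gt_atTop 0] with n h2 h3 h4 h5
    have h6 := h1 n h4
    have hn : (0 : ℝ) < n := by exact_mod_cast h5
    rw [Finset.sum_const, Nat.card_Ico, nsmul_eq_mul, Nat.cast_sub h4] at h6
    rw [lt_div_iff₀ hn] at h2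
    rw [div_le_iff₀ (by positivity)] at h3
    have : 0 ≤ (N : ℝ) * (E / 4) := by positivity
    nlinarith
  set r := Real.exp (-(E / 4)) with hr
  have hr0 : 0 ≤ r := (Real.exp_pos _).le
  have hr1 : r < 1 := (Real.exp_lt_exp.2 (by linarith)).trans_eq Real.exp_zero
  obtain ⟨M, hM⟩ := eventually_atTop.1 (hlin.and hrec)
  have h2 := htel (fun n => K * r ^ n) M fun n hn => by
    refine le_trans (sub_le_sub_left (mul_le_mul_of_nonneg_left ?_ hK) _) (hM n hn).2
    rw [hr, ← Real.exp_nat_mul]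
    exact Real.exp_le_exp.2 (by linarith [(hM n hn).1])
  refine ⟨-(y M - S M) + K * (1 - r)⁻¹, eventually_atTop.2 ⟨M, fun n hn => ?_⟩⟩
  have h3 : ∑ k ∈ Finset.Ico M n, K * r ^ k ≤ K * (1 - r)⁻¹ := by
    rw [← Finset.mul_sum]
    exact mul_le_mul_of_nonneg_left
      (sum_le_hasSum _ (fun _ _ => by positivity) (hasSum_geometric_of_lt_one hr0 hr1)) hK
  linarith [h2 n hn]

/-- For `L = -log_2 z` the recursion reads `L(n+1) ≥ D(n) L(n) - K`. Taking logarithms, `y = log L`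
gains `log D(n)` up to an error `O(1/L(n)) = O(exp(-y n))`, and `exists_sub_le_of_recursion`
applies. -/
theorem le_two_rpow_of_recursion {ℓ : ℕ} (hℓ : 2 ≤ ℓ) {z : ℕ → ℝ} {D : ℕ → ℕ} {C E : ℝ}
    (hC : 1 ≤ C) (hD : ∀ n, 1 ≤ D n) (hz0 : ∀ n, 0 ≤ z n)
    (hrec : ∀ n, z (n + 1) ≤ C * z n ^ D n) (hz : Tendsto z atTop (𝓝 0)) (hE : 0 < E)
    (hS : Tendsto (fun n : ℕ => (∑ k ∈ Finset.range n, Real.logb ℓ (D k)) / n) atTop (𝓝 E)) :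
    ∃ R : ℝ, ∀ᶠ n in atTop,
      z n ≤ (2 : ℝ) ^ (-((ℓ : ℝ) ^ ((∑ k ∈ Finset.range n, Real.logb ℓ (D k)) - R))) := by
  -- Zero is absorbing because the exponents are positive; otherwise all logarithms are legitimate.
  by_cases hex : ∃ m, z m = 0
  · obtain ⟨m, hm⟩ := hex
    refine ⟨0, eventually_atTop.2 ⟨m, fun n hn => ?_⟩⟩
    have : z n = 0 := by
      induction n, hn using Nat.le_induction with
      | base => exact hm
      | succ n hn ih =>
        have h := hrec n
        rw [ih, zero_pow (by have := hD n; omega), mul_zero] at h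
        exact le_antisymm h (hz0 _)
    rw [this]
    positivity
  push Not at hex
  have hzp : ∀ n, 0 < z n := fun n => lt_of_le_of_ne (hz0 n) (hex n).symm
  have hl1 : (1 : ℝ) < ℓ := by exact_mod_cast hℓ
  have hlogl : 0 < Real.log ℓ := Real.log_pos hl1
  set K := Real.logb 2 C with hKdef
  have hK : 0 ≤ K := Real.logb_nonneg (by norm_num) hC
  let L : ℕ → ℝ := fun n => -Real.logb 2 (z n)
  have hL : Tendsto L atTop atTop := by
    have h1 : Tendsto z atTop (𝓝[>] 0) :=
      tendsto_nhdsWithin_iff.2 ⟨hz, Eventually.of_forall hzp⟩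
    have h2 := (tendsto_neg_atBot_atTop.comp (Real.tendsto_log_nhdsGT_zero.comp h1)).atTop_div_const
      (Real.log_pos one_lt_two)
    refine h2.congr fun n => ?_
    simp only [L, Real.logb, Function.comp_apply]
    rw [neg_div]
  have hLrec : ∀ n, D n * L n - K ≤ L (n + 1) := by
    intro n
    have h := Real.logb_le_logb_of_le one_lt_two (hzp (n + 1)) (hrec n)
    rw [Real.logb_mul (by linarith) (pow_pos (hzp n) _).ne', Real.logb_pow] at h
    simp only [L]
    linarith
  have hy := Real.tendsto_log_atTop.comp hL
  have hSlog : Tendsto (fun n : ℕ => (∑ k ∈ Finset.range n, Real.log (D k)) / n) atTop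
      (𝓝 (E * Real.log ℓ)) := by
    refine (hS.mul_const (Real.log ℓ)).congr fun n => ?_
    rw [div_mul_eq_mul_div, Finset.sum_mul]
    congr 1
    refine Finset.sum_congr rfl fun k _ => ?_
    rw [Real.logb, div_mul_cancel₀ _ hlogl.ne']
  obtain ⟨R, hR⟩ := exists_sub_le_of_recursion (K := 2 * K) (by positivity) (by positivity) hy
    hSlog (by
      filter_upwards [hL.eventually_ge_atTop (2 * K + 1)] with n hn
      have hLn : 0 < L n := by linarith
      have hDn : (1 : ℝ) ≤ D n := by exact_mod_cast hD n
      have hf : 0 < 1 - K / L n := by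
        rw [sub_pos, div_lt_one hLn]
        linarith
      have h1 : (D n * L n) * (1 - K / L n) ≤ L (n + 1) := by
        refine le_trans ?_ (hLrec n)
        rw [mul_sub, mul_one, mul_assoc, mul_div_cancel₀ _ hLn.ne']
        nlinarith
      have h2 := Real.log_le_log (by positivity) h1
      rw [Real.log_mul (by positivity) hf.ne', Real.log_mul (by positivity) hLn.ne'] at h2
      have h3 := Real.one_sub_inv_le_log_of_pos hf
      -- The doubling of `K` originates here: `K/(L - K) ≤ 2K/L` once `L ≥ 2K`.
      have h4 : -(2 * K * (L n)⁻¹) ≤ 1 - (1 - K / L n)⁻¹ := by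
        have e : 1 - (1 - K / L n)⁻¹ = -(K / (L n - K)) := by
          have : L n - K ≠ 0 := by linarith
          have h5 : 1 - K / L n = (L n - K) / L n := by field_simp
          rw [h5, inv_div]
          field_simp
          ring
        rw [e, neg_le_neg_iff, ← div_eq_mul_inv, div_le_div_iff₀ (by linarith) hLn]
        nlinarith
      have h5 : Real.exp (-Real.log (L n)) = (L n)⁻¹ := by
        rw [Real.exp_neg, Real.exp_log hLn]
      simp only [Function.comp_apply]
      rw [Finset.sum_range_succ, h5]
      linarith)
  refine ⟨R / Real.log ℓ, ?_⟩
  filter_upwards [hR, hL.eventually_gt_atTop 0] with n hn hLn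
  have e1 : z n = (2 : ℝ) ^ (-L n) := by
    simp only [L, neg_neg]
    rw [Real.rpow_logb (by norm_num) (by norm_num) (hzp n)]
  rw [e1]
  refine Real.rpow_le_rpow_of_exponent_le (by norm_num) (neg_le_neg ?_)
  rw [← Real.exp_log hLn, Real.rpow_def_of_pos (by linarith)]
  refine Real.exp_le_exp.2 (le_trans (le_of_eq ?_) hn)
  rw [mul_sub, mul_div_cancel₀ _ hlogl.ne', Finset.mul_sum]
  congr 1
  refine Finset.sum_congr rfl fun k _ => ?_
  rw [Real.logb, mul_div_cancel₀ _ hlogl.ne']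

/-- Iteration gives `z n ≥ c ^ ∏ D k`. `R` only has to satisfy `ℓ^R ≥ -log_2 c`, so it serves all
sequences, that is all paths, at once. -/
theorem two_rpow_le_of_recursion {ℓ : ℕ} (hℓ : 2 ≤ ℓ) {c : ℝ} (hc0 : 0 < c) :
    ∃ R : ℝ, ∀ (z : ℕ → ℝ) (D : ℕ → ℕ), z 0 = c → (∀ n, 1 ≤ D n) → (∀ n, 0 ≤ z n) →
      (∀ n, z n ^ D n ≤ z (n + 1)) → ∀ n,
      (2 : ℝ) ^ (-((ℓ : ℝ) ^ ((∑ k ∈ Finset.range n, Real.logb ℓ (D k)) + R))) ≤ z n := by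
  have hl1 : (1 : ℝ) < ℓ := by exact_mod_cast hℓ
  obtain ⟨R, hR⟩ : ∃ R : ℝ, -Real.logb 2 c ≤ (ℓ : ℝ) ^ R :=
    ((tendsto_rpow_atTop_of_base_gt_one _ hl1).eventually_ge_atTop _).exists
  refine ⟨R, fun z D hz hD hz0 hrec n => ?_⟩
  have h1 : ∀ n, c ^ (∏ k ∈ Finset.range n, D k) ≤ z n := by
    intro n
    induction n with
    | zero => simp [hz]
    | succ n ih =>
      rw [Finset.prod_range_succ, pow_mul]
      exact (pow_le_pow_left₀ (by positivity) ih _).trans (hrec n)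
  refine le_trans ?_ (h1 n)
  have e : c = (2 : ℝ) ^ (Real.logb 2 c) :=
    (Real.rpow_logb (by norm_num) (by norm_num) hc0).symm
  have hP : (ℓ : ℝ) ^ (∑ k ∈ Finset.range n, Real.logb ℓ (D k)) =
      ((∏ k ∈ Finset.range n, D k : ℕ) : ℝ) := by
    have hpos : ∀ k, (0 : ℝ) < D k := fun k => by exact_mod_cast hD k
    rw [← Real.logb_prod _ _ fun k _ => (hpos k).ne',
      Real.rpow_logb (by linarith) hl1.ne' (Finset.prod_pos fun k _ => hpos k)]
    push_cast
    rfl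
  conv_rhs => rw [e]
  rw [← Real.rpow_natCast, ← Real.rpow_mul (by norm_num)]
  refine Real.rpow_le_rpow_of_exponent_le (by norm_num) ?_
  rw [Real.rpow_add (by linarith), hP]
  nlinarith [mul_le_mul_of_nonneg_left hR
    (Nat.cast_nonneg (α := ℝ) (∏ k ∈ Finset.range n, D k))]

/-! ### The Gaussian tail -/

theorem integrable_exp_neg_sq_div_two : Integrable fun x : ℝ => Real.exp (-(x ^ 2) / 2) := by
  refine (integrable_exp_neg_mul_sq (b := 1 / 2) (by norm_num)).congr
    (Eventually.of_forall fun x => ?_)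
  simp only
  congr 1
  ring

theorem continuous_gaussianQ : Continuous gaussianQ := by
  have h : gaussianQ = fun t => (1 / Real.sqrt (2 * Real.pi)) *
      ((∫ x in Set.Ioi (0 : ℝ), Real.exp (-(x ^ 2) / 2)) -
        ∫ x in (0 : ℝ)..t, Real.exp (-(x ^ 2) / 2)) := by
    funext t
    rw [gaussianQ, ← intervalIntegral.integral_Ioi_sub_Ioi'
      integrable_exp_neg_sq_div_two.integrableOn integrable_exp_neg_sq_div_two.integrableOn]
    ring
  rw [h]
  exact continuous_const.mul (continuous_const.sub
    (integrable_exp_neg_sq_div_two.continuous_primitive 0))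

theorem gaussianReal_real_Ioi (t : ℝ) : (gaussianReal 0 1).real (Set.Ioi t) = gaussianQ t := by
  rw [Measure.real, gaussianReal_apply_eq_integral _ one_ne_zero,
    ENNReal.toReal_ofReal (integral_nonneg fun x => gaussianPDFReal_nonneg _ _ _), gaussianQ,
    ← integral_const_mul]
  congr 1
  funext x
  rw [gaussianPDFReal_def]
  simp

theorem gaussianQ_nonneg (t : ℝ) : 0 ≤ gaussianQ t := by
  rw [← gaussianReal_real_Ioi]
  exact measureReal_nonneg

theorem gaussianQ_le_one (t : ℝ) : gaussianQ t ≤ 1 := by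
  rw [← gaussianReal_real_Ioi]
  exact measureReal_le_one

/-! ### Sums of functions of independent uniform indices -/

section UniformIndices

variable {Ω : Type*} [MeasurableSpace Ω] {P : Measure Ω} {ℓ : ℕ}
  {B : ℕ → Ω → Fin ℓ}

theorem map_uniform_real_singleton (hBmeas : ∀ n, Measurable (B n))
    (hBunif : ∀ n i, P.real {ω | B n ω = i} = 1 / (ℓ : ℝ)) (n : ℕ) (i : Fin ℓ) :
    (P.map (B n)).real {i} = 1 / (ℓ : ℝ) := by
  rw [map_measureReal_apply (hBmeas n) (measurableSet_singleton i), ← hBunif n i]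
  rfl

variable [IsProbabilityMeasure P]

theorem integral_comp_uniform (hBmeas : ∀ n, Measurable (B n))
    (hBunif : ∀ n i, P.real {ω | B n ω = i} = 1 / (ℓ : ℝ)) (ψ : Fin ℓ → ℝ) (n : ℕ) :
    ∫ ω, ψ (B n ω) ∂P = (1 / (ℓ : ℝ)) * ∑ i, ψ i := by
  have hψ : Measurable ψ := measurable_from_top
  have : IsProbabilityMeasure (P.map (B n)) :=
    Measure.isProbabilityMeasure_map (hBmeas n).aemeasurable
  rw [← integral_map (hBmeas n).aemeasurable hψ.aestronglyMeasurable,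
    integral_fintype Integrable.of_finite, Finset.mul_sum]
  refine Finset.sum_congr rfl fun i _ => ?_
  rw [map_uniform_real_singleton hBmeas hBunif, smul_eq_mul]

theorem identDistrib_uniform (hBmeas : ∀ n, Measurable (B n))
    (hBunif : ∀ n i, P.real {ω | B n ω = i} = 1 / (ℓ : ℝ)) (ψ : Fin ℓ → ℝ) (n : ℕ) :
    IdentDistrib (fun ω => ψ (B n ω)) (fun ω => ψ (B 0 ω)) P P := by
  have hψ : Measurable ψ := measurable_from_top
  refine IdentDistrib.comp (u := ψ) ⟨(hBmeas n).aemeasurable, (hBmeas 0).aemeasurable, ?_⟩ hψ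
  have : ∀ n, IsProbabilityMeasure (P.map (B n)) := fun n =>
    Measure.isProbabilityMeasure_map (hBmeas n).aemeasurable
  refine Measure.ext_of_singleton fun i => ?_
  rw [← measureReal_eq_measureReal_iff, map_uniform_real_singleton hBmeas hBunif,
    map_uniform_real_singleton hBmeas hBunif]

theorem tendsto_average_uniform (hBmeas : ∀ n, Measurable (B n)) (hBindep : iIndepFun B P)
    (hBunif : ∀ n i, P.real {ω | B n ω = i} = 1 / (ℓ : ℝ)) (ψ : Fin ℓ → ℝ) :
    ∀ᵐ ω ∂P, Tendsto (fun n : ℕ => (∑ k ∈ Finset.range n, ψ (B k ω)) / n) atTop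
      (𝓝 ((1 / (ℓ : ℝ)) * ∑ i, ψ i)) := by
  have hψ : Measurable ψ := measurable_from_top
  have h := strong_law_ae_real (fun n ω => ψ (B n ω)) (μ := P)
    (Integrable.of_bound (hψ.comp (hBmeas 0)).aestronglyMeasurable (∑ i, |ψ i|)
      (Eventually.of_forall fun ω => Finset.single_le_sum (f := fun i => |ψ i|)
        (fun i _ => abs_nonneg _) (Finset.mem_univ (B 0 ω))))
    (fun i j hij => (hBindep.indepFun hij).comp hψ hψ)
    (identDistrib_uniform hBmeas hBunif ψ)
  rwa [integral_comp_uniform hBmeas hBunif] at h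

theorem tendsto_normalized_uniform (hBmeas : ∀ n, Measurable (B n)) (hBindep : iIndepFun B P)
    (hBunif : ∀ n i, P.real {ω | B n ω = i} = 1 / (ℓ : ℝ)) (ψ : Fin ℓ → ℝ)
    (h0 : (1 / (ℓ : ℝ)) * ∑ i, ψ i = 0) (h1 : (1 / (ℓ : ℝ)) * ∑ i, ψ i ^ 2 = 1) (s : ℝ) :
    Tendsto (fun n : ℕ => P.real {ω | s < (√n)⁻¹ * ∑ k ∈ Finset.range n, ψ (B k ω)}) atTop
      (𝓝 (gaussianQ s)) := by
  have hψ : Measurable ψ := measurable_from_top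
  have hclt := tendstoInDistribution_inv_sqrt_mul_sum (P := P) (X := fun n ω => ψ (B n ω))
    (HasLaw.id (μ := gaussianReal 0 1))
    ((integral_comp_uniform hBmeas hBunif ψ 0).trans h0)
    ((integral_comp_uniform hBmeas hBunif (fun i => ψ i ^ 2) 0).trans h1)
    (hBindep.comp (fun _ => ψ) fun _ => hψ) (identDistrib_uniform hBmeas hBunif ψ)
  -- The Gaussian law has no atoms, so the half-line is a continuity set.
  have h2 := ProbabilityMeasure.tendsto_measure_of_null_frontier_of_tendsto' hclt.tendsto
    (E := Set.Ioi s) (by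
      simp only [ProbabilityMeasure.coe_mk, Measure.map_id, frontier_Ioi]
      have : NullSingletonClass (gaussianReal 0 1) :=
        nullSingletonClass_gaussianReal one_ne_zero
      exact measure_singleton s)
  simp only [ProbabilityMeasure.coe_mk, Measure.map_id] at h2
  rw [← gaussianReal_real_Ioi]
  refine ((ENNReal.tendsto_toReal (measure_ne_top _ _)).comp h2).congr fun n => ?_
  simp only [Function.comp_apply]
  rw [Measure.map_apply (by fun_prop) measurableSet_Ioi]
  rfl

end UniformIndices

/-! ### A central limit theorem that mixes with events of the past -/

section MixingLimit

variable {Ω : Type*} [MeasurableSpace Ω] {P : Measure Ω} {ℓ : ℕ}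
  {B : ℕ → Ω → Fin ℓ}

/-- The event `A` depends on the first `m` indices only. -/
def DependsOnFirst (B : ℕ → Ω → Fin ℓ) (m : ℕ) (A : Set Ω) : Prop :=
  ∃ A' : Set (Finset.range m → Fin ℓ), A = (fun ω (k : Finset.range m) => B k ω) ⁻¹' A'

theorem DependsOnFirst.measurableSet {m : ℕ} {A : Set Ω} (hA : DependsOnFirst B m A)
    (hBmeas : ∀ n, Measurable (B n)) : MeasurableSet A := by
  obtain ⟨A', rfl⟩ := hA
  have h : Measurable fun ω (k : Finset.range m) => B k ω :=
    measurable_pi_lambda _ fun k => hBmeas k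
  exact h (Set.toFinite A').measurableSet

theorem measure_inter_dependsOnFirst (hBmeas : ∀ n, Measurable (B n)) (hBindep : iIndepFun B P)
    {m : ℕ} {A : Set Ω} (hA : DependsOnFirst B m A) (φ : Fin ℓ → ℝ) (n : ℕ) (θ : ℝ) :
    P.real (A ∩ {ω | θ < ∑ k ∈ Finset.Ico m n, φ (B k ω)}) =
      P.real A * P.real {ω | θ < ∑ k ∈ Finset.Ico m n, φ (B k ω)} := by
  obtain ⟨A', rfl⟩ := hA
  have hdisj : Disjoint (Finset.range m) (Finset.Ico m n) := by
    rw [Finset.disjoint_left]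
    intro k hk hk'
    exact absurd (Finset.mem_Ico.1 hk').1 (not_le.2 (Finset.mem_range.1 hk))
  have h := (hBindep.indepFun_finset _ _ hdisj hBmeas).measure_inter_preimage_eq_mul A'
    {x | θ < ∑ k, φ (x k)} (Set.toFinite _).measurableSet (Set.toFinite _).measurableSet
  have e : {ω | θ < ∑ k ∈ Finset.Ico m n, φ (B k ω)} =
      (fun ω (k : Finset.Ico m n) => B k ω) ⁻¹' {x | θ < ∑ k, φ (x k)} := by
    ext ω
    simp only [Set.mem_ofPred_eq, Set.mem_preimage]
    rw [Finset.sum_coe_sort (Finset.Ico m n) fun k => φ (B k ω)]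
  rw [e, Measure.real, h, ENNReal.toReal_mul]
  rfl

variable [IsProbabilityMeasure P]

theorem tendsto_sum_uniform (hBmeas : ∀ n, Measurable (B n)) (hBindep : iIndepFun B P)
    (hBunif : ∀ n i, P.real {ω | B n ω = i} = 1 / (ℓ : ℝ)) (φ : Fin ℓ → ℝ) {E V : ℝ}
    (hE : E = (1 / (ℓ : ℝ)) * ∑ i, φ i) (hV : V = (1 / (ℓ : ℝ)) * ∑ i, (φ i - E) ^ 2)
    (hV0 : 0 < V) (s : ℝ) :
    Tendsto (fun n : ℕ => P.real {ω | E * n + s * √(V * n) <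
      ∑ k ∈ Finset.range n, φ (B k ω)}) atTop (𝓝 (gaussianQ s)) := by
  have hl : (0 : ℝ) < ℓ := by
    rcases Nat.eq_zero_or_pos ℓ with h | h
    · subst h
      simp only [CharP.cast_eq_zero, div_zero, zero_mul] at hV
      exact absurd hV hV0.ne'
    · exact_mod_cast h
  have hsV : 0 < √V := Real.sqrt_pos.2 hV0
  have h := tendsto_normalized_uniform hBmeas hBindep hBunif (fun i => (φ i - E) / √V)
    (by
      rw [← Finset.sum_div, Finset.sum_sub_distrib, Finset.sum_const, Finset.card_univ,
        Fintype.card_fin, nsmul_eq_mul, hE]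
      field_simp
      ring)
    (by
      simp_rw [div_pow, Real.sq_sqrt hV0.le]
      rw [← Finset.sum_div, ← mul_div_assoc, ← hV, div_self hV0.ne']) s
  refine h.congr' ?_
  filter_upwards [eventually_gt_atTop 0] with n hn
  have hn' : (0 : ℝ) < n := by exact_mod_cast hn
  have hsn : 0 < √(n : ℝ) := Real.sqrt_pos.2 hn'
  congr 1
  ext ω
  simp only [Set.mem_ofPred_eq]
  rw [← Finset.sum_div, Finset.sum_sub_distrib, Finset.sum_const, Finset.card_range, nsmul_eq_mul,
    inv_mul_eq_div, div_div, lt_div_iff₀ (by positivity), Real.sqrt_mul hV0.le, mul_comm E]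
  constructor <;> intro h <;> linarith

/-- Eventually `|f n|` is at most a small multiple of `√(V n)`, so the perturbation is absorbed by a
small change of `t`, and `gaussianQ` is continuous. -/
theorem tendsto_sum_uniform_perturbed (hBmeas : ∀ n, Measurable (B n)) (hBindep : iIndepFun B P)
    (hBunif : ∀ n i, P.real {ω | B n ω = i} = 1 / (ℓ : ℝ)) (φ : Fin ℓ → ℝ) {E V : ℝ}
    (hE : E = (1 / (ℓ : ℝ)) * ∑ i, φ i) (hV : V = (1 / (ℓ : ℝ)) * ∑ i, (φ i - E) ^ 2)
    (hV0 : 0 < V) (t : ℝ) {f : ℕ → ℝ} (hf : f =o[atTop] fun n : ℕ => √(n : ℝ)) :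
    Tendsto (fun n : ℕ => P.real {ω | E * n + t * √(V * n) + f n <
      ∑ k ∈ Finset.range n, φ (B k ω)}) atTop (𝓝 (gaussianQ t)) := by
  have hsV : 0 < √V := Real.sqrt_pos.2 hV0
  have hbound : ∀ ε > 0, ∀ᶠ n : ℕ in atTop, |f n| ≤ ε * √(V * n) := by
    intro ε hε
    filter_upwards [hf.bound (show 0 < ε * √V by positivity)] with n hn
    rw [Real.sqrt_mul hV0.le, ← mul_assoc]
    simpa [abs_of_nonneg (Real.sqrt_nonneg (n : ℝ))] using hn
  have hcont := continuous_gaussianQ.continuousAt (x := t)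
  rw [Metric.continuousAt_iff] at hcont
  rw [tendsto_order]
  constructor
  · intro a ha
    obtain ⟨δ, hδ, h⟩ := hcont (gaussianQ t - a) (by linarith)
    have h1 := h (x := t + δ / 2) (by rw [Real.dist_eq, add_sub_cancel_left, abs_of_pos] <;> linarith)
    rw [Real.dist_eq, abs_lt] at h1
    filter_upwards [(tendsto_sum_uniform hBmeas hBindep hBunif φ hE hV hV0
      (t + δ / 2)).eventually_const_lt (show a < _ by linarith [h1.1]),
      hbound (δ / 2) (by positivity)] with n hn hfn
    refine hn.trans_le (measureReal_mono fun ω hω => ?_)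
    simp only [Set.mem_ofPred_eq] at hω ⊢
    linarith [(abs_le.1 hfn).2]
  · intro a ha
    obtain ⟨δ, hδ, h⟩ := hcont (a - gaussianQ t) (by linarith)
    have h1 := h (x := t - δ / 2) (by
      rw [Real.dist_eq, sub_sub_cancel_left, abs_neg, abs_of_pos] <;> linarith)
    rw [Real.dist_eq, abs_lt] at h1
    filter_upwards [(tendsto_sum_uniform hBmeas hBindep hBunif φ hE hV hV0
      (t - δ / 2)).eventually_lt_const (show _ < a by linarith [h1.2]),
      hbound (δ / 2) (by positivity)] with n hn hfn
    refine lt_of_le_of_lt (measureReal_mono fun ω hω => ?_) hn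
    simp only [Set.mem_ofPred_eq] at hω ⊢
    linarith [(abs_le.1 hfn).1]

theorem isLittleO_const_sqrt (c : ℝ) :
    (fun _ : ℕ => c) =o[atTop] fun n : ℕ => √(n : ℝ) := by
  rw [Asymptotics.isLittleO_const_left]
  refine Or.inr ?_
  have : (norm ∘ fun n : ℕ => √(n : ℝ)) = fun n : ℕ => √(n : ℝ) := by
    funext n
    simp
  rw [this]
  exact Real.tendsto_sqrt_atTop.comp tendsto_natCast_atTop_atTop

theorem tendsto_inter_dependsOnFirst (hBmeas : ∀ n, Measurable (B n)) (hBindep : iIndepFun B P)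
    (hBunif : ∀ n i, P.real {ω | B n ω = i} = 1 / (ℓ : ℝ)) (φ : Fin ℓ → ℝ) {E V : ℝ}
    (hE : E = (1 / (ℓ : ℝ)) * ∑ i, φ i) (hV : V = (1 / (ℓ : ℝ)) * ∑ i, (φ i - E) ^ 2)
    (hV0 : 0 < V) (t : ℝ) {f : ℕ → ℝ} (hf : f =o[atTop] fun n : ℕ => √(n : ℝ))
    {m : ℕ} {A : Set Ω} (hA : DependsOnFirst B m A) :
    Tendsto (fun n : ℕ => P.real (A ∩ {ω | E * n + t * √(V * n) + f n <
      ∑ k ∈ Finset.range n, φ (B k ω)})) atTop (𝓝 (P.real A * gaussianQ t)) := by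
  set M : ℝ := ∑ k ∈ Finset.range m, ∑ i, |φ i| with hM
  have hSm : ∀ ω, |∑ k ∈ Finset.range m, φ (B k ω)| ≤ M := fun ω =>
    (Finset.abs_sum_le_sum_abs _ _).trans (Finset.sum_le_sum fun k _ =>
      Finset.single_le_sum (f := fun i => |φ i|) (fun i _ => abs_nonneg _)
        (Finset.mem_univ (B k ω)))
  have hlim : ∀ c : ℝ, Tendsto (fun n : ℕ => P.real A * P.real {ω | E * n + t * √(V * n) +
      (f n + c) < ∑ k ∈ Finset.range n, φ (B k ω)}) atTop (𝓝 (P.real A * gaussianQ t)) :=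
    fun c => (tendsto_sum_uniform_perturbed hBmeas hBindep hBunif φ hE hV hV0 t
      (hf.add (isLittleO_const_sqrt c))).const_mul _
  have hsplit : ∀ n ≥ m, ∀ ω, ∑ k ∈ Finset.range n, φ (B k ω) =
      ∑ k ∈ Finset.range m, φ (B k ω) + ∑ k ∈ Finset.Ico m n, φ (B k ω) :=
    fun n hn ω => (Finset.sum_range_add_sum_Ico _ hn).symm
  -- One `M` pays for dropping the first `m` increments, which yields independence from `A`; the
  -- other pays for restoring them.
  refine tendsto_of_tendsto_of_tendsto_of_le_of_le' (hlim (2 * M)) (hlim (-(2 * M))) ?_ ?_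
  · filter_upwards [eventually_ge_atTop m] with n hn
    have h := measure_inter_dependsOnFirst hBmeas hBindep hA φ n
      (E * n + t * √(V * n) + (f n + M))
    refine le_trans ?_ (h.symm.le.trans (measureReal_mono (Set.inter_subset_inter_right _ ?_)))
    · refine mul_le_mul_of_nonneg_left (measureReal_mono fun ω hω => ?_) measureReal_nonneg
      simp only [Set.mem_ofPred_eq] at hω ⊢
      have := abs_le.1 (hSm ω)
      rw [hsplit n hn] at hω
      linarith [this.2]
    · intro ω hω
      simp only [Set.mem_ofPred_eq] at hω ⊢
      have := abs_le.1 (hSm ω)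
      rw [hsplit n hn]
      linarith [this.1]
  · filter_upwards [eventually_ge_atTop m] with n hn
    have h := measure_inter_dependsOnFirst hBmeas hBindep hA φ n
      (E * n + t * √(V * n) + (f n - M))
    refine (measureReal_mono (Set.inter_subset_inter_right _ ?_)).trans (h.le.trans ?_)
    · intro ω hω
      simp only [Set.mem_ofPred_eq] at hω ⊢
      have := abs_le.1 (hSm ω)
      rw [hsplit n hn] at hω
      linarith [this.2]
    · refine mul_le_mul_of_nonneg_left (measureReal_mono fun ω hω => ?_) measureReal_nonneg
      simp only [Set.mem_ofPred_eq] at hω ⊢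
      have := abs_le.1 (hSm ω)
      rw [hsplit n hn]
      linarith [this.1]

/-- A mixing central limit theorem, with `o(√n)` perturbations of the threshold. -/
theorem tendsto_inter_of_approx (hBmeas : ∀ n, Measurable (B n)) (hBindep : iIndepFun B P)
    (hBunif : ∀ n i, P.real {ω | B n ω = i} = 1 / (ℓ : ℝ)) (φ : Fin ℓ → ℝ) {E V : ℝ}
    (hE : E = (1 / (ℓ : ℝ)) * ∑ i, φ i) (hV : V = (1 / (ℓ : ℝ)) * ∑ i, (φ i - E) ^ 2)
    (hV0 : 0 < V) (t : ℝ) {f : ℕ → ℝ} (hf : f =o[atTop] fun n : ℕ => √(n : ℝ))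
    {A : Set Ω} (hAm : MeasurableSet A) {A' : ℕ → Set Ω}
    (hA' : ∀ m, DependsOnFirst B m (A' m))
    (happ : ∀ᵐ ω ∂P, ∀ᶠ m in atTop, ω ∈ A' m ↔ ω ∈ A) :
    Tendsto (fun n : ℕ => P.real (A ∩ {ω | E * n + t * √(V * n) + f n <
      ∑ k ∈ Finset.range n, φ (B k ω)})) atTop (𝓝 (P.real A * gaussianQ t)) := by
  have hA'm := fun m => (hA' m).measurableSet hBmeas
  -- Replacing `A` by a fixed `A' m` costs one `ε / 3` in the intersection and one in the limit;
  -- convergence for `A' m` uses the third.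
  have hsymm : Tendsto (fun m => P.real (symmDiff A (A' m))) atTop (𝓝 0) := by
    have h := tendsto_measure_of_ae_tendsto_indicator_of_isFiniteMeasure atTop
      (μ := P) (A := ∅) (As := fun m => symmDiff A (A' m)) MeasurableSet.empty
      (fun m => hAm.symmDiff (hA'm m)) (by
        filter_upwards [happ] with ω hω
        filter_upwards [hω] with m hm
        simp only [Set.mem_symmDiff, hm, Set.mem_empty_iff_false, iff_false]
        tauto)
    rw [measure_empty] at h
    exact (ENNReal.tendsto_toReal ENNReal.zero_ne_top).comp h
  rw [Metric.tendsto_atTop]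
  intro ε hε
  obtain ⟨m, hm⟩ := (hsymm.eventually_lt_const (show (0 : ℝ) < ε / 3 by positivity)).exists
  have h1 := tendsto_inter_dependsOnFirst hBmeas hBindep hBunif φ hE hV hV0 t hf (hA' m)
  rw [Metric.tendsto_atTop] at h1
  obtain ⟨N, hN⟩ := h1 (ε / 3) (by positivity)
  refine ⟨N, fun n hn => ?_⟩
  set D := {ω | E * n + t * √(V * n) + f n < ∑ k ∈ Finset.range n, φ (B k ω)} with hD
  have hDm : MeasurableSet D := by
    refine measurableSet_lt measurable_const (Finset.measurable_fun_sum _ fun k _ => ?_)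
    exact (measurable_from_top (f := φ)).comp (hBmeas k)
  have h2 : |P.real (A ∩ D) - P.real (A' m ∩ D)| ≤ P.real (symmDiff A (A' m)) := by
    refine (abs_measureReal_sub_le_measureReal_symmDiff (hAm.inter hDm).nullMeasurableSet
      ((hA'm m).inter hDm).nullMeasurableSet).trans (measureReal_mono fun ω hω => ?_)
    simp only [Set.mem_symmDiff, Set.mem_inter_iff] at hω ⊢
    tauto
  have h3 : |P.real A - P.real (A' m)| ≤ P.real (symmDiff A (A' m)) :=
    abs_measureReal_sub_le_measureReal_symmDiff hAm.nullMeasurableSet (hA'm m).nullMeasurableSet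
  have h4 := hN n hn
  rw [Real.dist_eq] at h4 ⊢
  have h5 : |(P.real (A' m) - P.real A) * gaussianQ t| ≤ P.real (symmDiff A (A' m)) := by
    rw [abs_mul, abs_sub_comm, abs_of_nonneg (gaussianQ_nonneg t)]
    exact (mul_le_of_le_one_right (abs_nonneg _) (gaussianQ_le_one t)).trans h3
  rw [abs_lt] at h4 ⊢
  rw [abs_le] at h2 h5
  constructor <;> linarith [h2.1, h2.2, h4.1, h4.2, h5.1, h5.2]

end MixingLimit

/-! ### The capacity martingale -/

namespace DMC

section Paths

variable {X : Type u} [Fintype X] [DecidableEq X] (W : DMC X) {ℓ : ℕ}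
  (g : (Fin ℓ → X) → (Fin ℓ → X))

theorem iter_congr {b b' : ℕ → Fin ℓ} {n : ℕ} (h : ∀ k < n, b k = b' k) :
    W.iter g b n = W.iter g b' n := by
  induction n with
  | zero => rfl
  | succ n ih =>
    rw [iter, iter, ih fun k hk => h k (by omega), h n (by omega)]

/-- The channel `W^{(x 0)⋯(x (n-1))}` for a finite sequence of indices. -/
noncomputable def iterFirst (i₀ : Fin ℓ) (n : ℕ) (x : Finset.range n → Fin ℓ) : DMC X :=
  -- The default `i₀` is never read: only indices below `n` enter.
  W.iter g (fun k => if h : k ∈ Finset.range n then x ⟨k, h⟩ else i₀) n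

theorem iterFirst_eq (i₀ : Fin ℓ) (n : ℕ) (b : ℕ → Fin ℓ) :
    W.iterFirst g i₀ n (fun k => b k) = W.iter g b n :=
  W.iter_congr g fun k hk => by simp [hk]

end Paths

variable {X : Type u} [Fintype X] [DecidableEq X] {Ω : Type*} {ℓ : ℕ} {B : ℕ → Ω → Fin ℓ}

theorem dependsOnFirst_iter (hℓ : 0 < ℓ) (W : DMC X) (g : (Fin ℓ → X) → (Fin ℓ → X)) (n : ℕ)
    (p : DMC X → Prop) : DependsOnFirst B n {ω | p (W.iter g (fun k => B k ω) n)} := by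
  refine ⟨{x | p (W.iterFirst g ⟨0, hℓ⟩ n x)}, ?_⟩
  ext ω
  change _ ↔ p (W.iterFirst g ⟨0, hℓ⟩ n fun k => B k ω)
  rw [W.iterFirst_eq g ⟨0, hℓ⟩ n fun k => B k ω]
  rfl

variable [MeasurableSpace Ω]

/-- The filtration generated by the first `n` indices. -/
def indexFiltration (hBmeas : ∀ n, Measurable (B n)) :
    Filtration ℕ (inferInstance : MeasurableSpace Ω) where
  seq n := MeasurableSpace.comap (fun ω (k : Finset.range n) => B k ω) inferInstance
  mono' n m hnm := by
    have hr : Measurable fun (x : Finset.range m → Fin ℓ) (k : Finset.range n) =>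
        x ⟨k, Finset.range_mono hnm k.2⟩ := measurable_pi_lambda _ fun k => measurable_pi_apply _
    have : (fun ω (k : Finset.range n) => B k ω) =
        (fun (x : Finset.range m → Fin ℓ) (k : Finset.range n) =>
          x ⟨k, Finset.range_mono hnm k.2⟩) ∘ fun ω (k : Finset.range m) => B k ω := rfl
    simp only
    rw [this, ← MeasurableSpace.comap_comp]
    exact MeasurableSpace.comap_mono hr.comap_le
  le' n := (measurable_pi_lambda _ fun k : Finset.range n => hBmeas k).comap_le

variable (W : DMC X) (g : (Fin ℓ → X) → (Fin ℓ → X))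

theorem measurable_symCap_iter (hℓ : 0 < ℓ) (hBmeas : ∀ n, Measurable (B n)) (n : ℕ) :
    Measurable[indexFiltration hBmeas n] fun ω => (W.iter g (fun k => B k ω) n).symCap := by
  have h : (fun ω => (W.iter g (fun k => B k ω) n).symCap) =
      (fun x => (W.iterFirst g ⟨0, hℓ⟩ n x).symCap) ∘ fun ω (k : Finset.range n) => B k ω := by
    funext ω
    rw [Function.comp_apply, W.iterFirst_eq g ⟨0, hℓ⟩ n fun k => B k ω]
  rw [h]
  exact (measurable_of_finite _).comp (comap_measurable _)

theorem measurable_limCap (hℓ : 0 < ℓ) (hBmeas : ∀ n, Measurable (B n)) :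
    Measurable fun ω => W.limCap g fun n => B n ω :=
  Measurable.limsup fun n => (measurable_symCap_iter W g hℓ hBmeas n).mono
    ((indexFiltration hBmeas).le n) le_rfl

variable {P : Measure Ω} [IsProbabilityMeasure P]

/-- The past and `B n` have a product joint law, so Fubini integrates out `B n` first. -/
theorem integral_first_uniform (hBmeas : ∀ n, Measurable (B n)) (hBindep : iIndepFun B P)
    (hBunif : ∀ n i, P.real {ω | B n ω = i} = 1 / (ℓ : ℝ)) (n : ℕ)
    (H : (Finset.range n → Fin ℓ) → Fin ℓ → ℝ) :
    ∫ ω, H (fun k => B k ω) (B n ω) ∂P =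
      ∫ ω, (1 / (ℓ : ℝ)) * ∑ i, H (fun k => B k ω) i ∂P := by
  have hX : Measurable fun ω (k : Finset.range n) => B k ω :=
    measurable_pi_lambda _ fun k => hBmeas k
  have hindep : IndepFun (fun ω (k : Finset.range n) => B k ω) (B n) P := by
    have h := hBindep.indepFun_finset (Finset.range n) {n} (by simp) hBmeas
    have hn : Measurable fun x : ({n} : Finset ℕ) → Fin ℓ => x ⟨n, by simp⟩ :=
      measurable_pi_apply _
    exact h.comp measurable_id hn
  have hp1 := Measure.isProbabilityMeasure_map (μ := P) hX.aemeasurable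
  have hp2 := Measure.isProbabilityMeasure_map (μ := P) (hBmeas n).aemeasurable
  have hmap := (indepFun_iff_map_prod_eq_prod_map_map hX.aemeasurable
    (hBmeas n).aemeasurable).1 hindep
  have hHm : Measurable (Function.uncurry H) := measurable_of_finite _
  have h1 : ∫ ω, H (fun k => B k ω) (B n ω) ∂P = ∫ p, Function.uncurry H p
      ∂(P.map fun ω => ((fun k : Finset.range n => B k ω), B n ω)) := by
    rw [integral_map (hX.prodMk (hBmeas n)).aemeasurable hHm.aestronglyMeasurable]
    rfl
  rw [h1, hmap, integral_prod _ Integrable.of_finite,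
    integral_map hX.aemeasurable (measurable_of_finite _).aestronglyMeasurable]
  congr 1
  funext ω
  rw [integral_fintype Integrable.of_finite, Finset.mul_sum]
  refine Finset.sum_congr rfl fun i _ => ?_
  rw [map_uniform_real_singleton hBmeas hBunif, smul_eq_mul]
  rfl

variable [Nontrivial X]

theorem integrable_symCap_iter (hℓ : 0 < ℓ) (hBmeas : ∀ n, Measurable (B n)) (n : ℕ) :
    Integrable (fun ω => (W.iter g (fun k => B k ω) n).symCap) P :=
  Integrable.of_bound (((measurable_symCap_iter W g hℓ hBmeas n).mono
    ((indexFiltration hBmeas).le n) le_rfl).aestronglyMeasurable) 1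
    (Eventually.of_forall fun _ => abs_symCap_le_one _)

theorem setIntegral_symCap_iter_succ (hℓ : 0 < ℓ) (hg : Function.Bijective g)
    (hBmeas : ∀ n, Measurable (B n)) (hBindep : iIndepFun B P)
    (hBunif : ∀ n i, P.real {ω | B n ω = i} = 1 / (ℓ : ℝ)) (n : ℕ) {s : Set Ω}
    (hs : MeasurableSet[indexFiltration hBmeas n] s) :
    ∫ ω in s, (W.iter g (fun k => B k ω) (n + 1)).symCap ∂P =
      ∫ ω in s, (W.iter g (fun k => B k ω) n).symCap ∂P := by
  have hsm : MeasurableSet s := (indexFiltration hBmeas).le n s hs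
  have hl : (0 : ℝ) < ℓ := by exact_mod_cast hℓ
  obtain ⟨A, -, rfl⟩ := hs
  classical
  rw [← integral_indicator hsm, ← integral_indicator hsm]
  -- `s` is the preimage of a set `A` of index words, so its indicator is a function of the past;
  -- averaging over `i` is then `sum_symCap_sub`.
  have h := integral_first_uniform hBmeas hBindep hBunif n fun x i =>
    if x ∈ A then ((W.iterFirst g ⟨0, hℓ⟩ n x).sub g i).symCap else 0
  convert! h using 2
  · funext ω
    rw [W.iterFirst_eq g ⟨0, hℓ⟩ n fun k => B k ω]
    rfl
  · funext ω
    rw [W.iterFirst_eq g ⟨0, hℓ⟩ n fun k => B k ω]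
    by_cases hω : (fun k : Finset.range n => B k ω) ∈ A
    · simp only [hω, if_true]
      rw [sum_symCap_sub _ _ hg, Set.indicator_of_mem (by exact hω)]
      field_simp
    · simp only [hω, if_false]
      rw [Set.indicator_of_notMem (by exact hω)]
      simp

theorem submartingale_symCap_iter (hℓ : 0 < ℓ) (hg : Function.Bijective g)
    (hBmeas : ∀ n, Measurable (B n)) (hBindep : iIndepFun B P)
    (hBunif : ∀ n i, P.real {ω | B n ω = i} = 1 / (ℓ : ℝ)) :
    Submartingale (fun n ω => (W.iter g (fun k => B k ω) n).symCap) (indexFiltration hBmeas) P :=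
  submartingale_of_setIntegral_le_succ
    (fun n => (measurable_symCap_iter W g hℓ hBmeas n).stronglyMeasurable)
    (fun n => integrable_symCap_iter W g hℓ hBmeas n)
    fun n _ hs => (setIntegral_symCap_iter_succ W g hℓ hg hBmeas hBindep hBunif n hs).ge

theorem integral_symCap_iter (hℓ : 0 < ℓ) (hg : Function.Bijective g)
    (hBmeas : ∀ n, Measurable (B n)) (hBindep : iIndepFun B P)
    (hBunif : ∀ n i, P.real {ω | B n ω = i} = 1 / (ℓ : ℝ)) (n : ℕ) :
    ∫ ω, (W.iter g (fun k => B k ω) n).symCap ∂P = W.symCap := by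
  induction n with
  | zero => simp [iter]
  | succ n ih =>
    rw [← ih]
    simpa using setIntegral_symCap_iter_succ W g hℓ hg hBmeas hBindep hBunif n
      (MeasurableSet.univ (m := _))

theorem tendsto_symCap_iter (hℓ : 0 < ℓ) (hg : Function.Bijective g)
    (hBmeas : ∀ n, Measurable (B n)) (hBindep : iIndepFun B P)
    (hBunif : ∀ n i, P.real {ω | B n ω = i} = 1 / (ℓ : ℝ)) :
    ∀ᵐ ω ∂P, Tendsto (fun n => (W.iter g (fun k => B k ω) n).symCap) atTop
      (𝓝 (W.limCap g fun n => B n ω)) := by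
  have h := (submartingale_symCap_iter W g hℓ hg hBmeas hBindep hBunif).exists_ae_tendsto_of_bdd
    (R := 1) fun n => by
      refine (eLpNorm_le_of_ae_bound (Eventually.of_forall fun ω => abs_symCap_le_one _)).trans ?_
      simp
  filter_upwards [h] with ω ⟨c, hc⟩
  rw [limCap, hc.limsup_eq]
  exact hc

/-- Dominated convergence carries the constant expectation `I(W)` to `I_∞`, which is almost surely
the indicator of this event. -/
theorem prob_limCap_eq_one (hℓ : 0 < ℓ) (hg : Function.Bijective g)
    (hBmeas : ∀ n, Measurable (B n)) (hBindep : iIndepFun B P)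
    (hBunif : ∀ n i, P.real {ω | B n ω = i} = 1 / (ℓ : ℝ))
    (hpol : ∀ᵐ ω ∂P, W.limCap g (fun n => B n ω) ∈ ({0, 1} : Set ℝ)) :
    P.real {ω | W.limCap g (fun n => B n ω) = 1} = W.symCap := by
  have h1 : Tendsto (fun n => ∫ ω, (W.iter g (fun k => B k ω) n).symCap ∂P) atTop
      (𝓝 (∫ ω, W.limCap g (fun n => B n ω) ∂P)) :=
    tendsto_integral_of_dominated_convergence (fun _ => 1)
      (fun n => (integrable_symCap_iter W g hℓ hBmeas n).aestronglyMeasurable)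
      (integrable_const _) (fun n => Eventually.of_forall fun _ => abs_symCap_le_one _)
      (tendsto_symCap_iter W g hℓ hg hBmeas hBindep hBunif)
  simp_rw [integral_symCap_iter W g hℓ hg hBmeas hBindep hBunif] at h1
  have hset : MeasurableSet {ω | W.limCap g (fun n => B n ω) = 1} :=
    measurable_limCap W g hℓ hBmeas (measurableSet_singleton 1)
  rw [tendsto_nhds_unique tendsto_const_nhds h1, ← integral_indicator_one hset]
  refine integral_congr_ae ?_
  filter_upwards [hpol] with ω hω
  rcases hω with h0 | h0
  · rw [Set.indicator_of_notMem, h0]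
    change ¬ (W.limCap g fun n => B n ω) = 1
    rw [h0]
    norm_num
  · have h0' : (W.limCap g fun n => B n ω) = 1 := h0
    rw [Set.indicator_of_mem, h0', Pi.one_apply]
    exact h0'

end DMC

/-! ### Limits of the exceptional events -/

theorem le_liminf_of_tendsto_of_le {u a : ℕ → ℝ} {x c : ℝ} (ha : Tendsto a atTop (𝓝 x))
    (h : ∀ᶠ n in atTop, a n ≤ u n) (hu : ∀ n, u n ≤ c) : x ≤ liminf u atTop := by
  rw [← ha.liminf_eq]
  exact liminf_le_liminf h ha.isBoundedUnder_ge
    (isBoundedUnder_of ⟨c, hu⟩ : IsBoundedUnder (· ≤ ·) atTop u).isCoboundedUnder_ge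

theorem limsup_le_of_le_tendsto {u a : ℕ → ℝ} {x c : ℝ} (ha : Tendsto a atTop (𝓝 x))
    (h : ∀ᶠ n in atTop, u n ≤ a n) (hu : ∀ n, c ≤ u n) : limsup u atTop ≤ x := by
  rw [← ha.limsup_eq]
  exact limsup_le_limsup h
    (isBoundedUnder_of ⟨c, hu⟩ : IsBoundedUnder (· ≥ ·) atTop u).isCoboundedUnder_le
    ha.isBoundedUnder_le

theorem tendsto_measureReal_of_eventually_notMem {Ω : Type*} [MeasurableSpace Ω] {P : Measure Ω}
    [IsFiniteMeasure P] {s : ℕ → Set Ω} (hs : ∀ n, MeasurableSet (s n))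
    (h : ∀ᵐ ω ∂P, ∀ᶠ n in atTop, ω ∉ s n) : Tendsto (fun n => P.real (s n)) atTop (𝓝 0) := by
  have h1 := tendsto_measure_of_ae_tendsto_indicator_of_isFiniteMeasure atTop
    (μ := P) (A := ∅) (As := s) MeasurableSet.empty hs (by
      filter_upwards [h] with ω hω
      filter_upwards [hω] with n hn
      simp [hn])
  rw [measure_empty] at h1
  exact (ENNReal.tendsto_toReal ENNReal.zero_ne_top).comp h1

theorem tendsto_sqrt_sqrt_atTop : Tendsto (fun n : ℕ => √√(n : ℝ)) atTop atTop :=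
  Real.tendsto_sqrt_atTop.comp (Real.tendsto_sqrt_atTop.comp tendsto_natCast_atTop_atTop)

theorem isLittleO_sqrt_of_tendsto {v : ℕ → ℝ} (hv : Tendsto v atTop atTop) :
    (fun n => √(v n)) =o[atTop] v := by
  refine Asymptotics.isLittleO_of_tendsto' ?_ ?_
  · filter_upwards [hv.eventually_gt_atTop 0] with n hn h0
    exact absurd h0 hn.ne'
  · have h : Tendsto (fun n => (√(v n))⁻¹) atTop (𝓝 0) :=
      tendsto_inv_atTop_zero.comp (Real.tendsto_sqrt_atTop.comp hv)
    refine h.congr' ?_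
    filter_upwards [hv.eventually_gt_atTop 0] with n hn
    rw [Real.sqrt_div_self', one_div]

/-- Together with `two_rpow_neg_rpow_le_half` this keeps the threshold for `Z` at most 1/2, out of
reach on paths where `Z → 1`. -/
theorem eventually_threshold_nonneg {E V t : ℝ} (hE : 0 < E) (hV : 0 ≤ V) {f : ℕ → ℝ}
    (hf : f =o[atTop] fun n : ℕ => √(n : ℝ)) :
    ∀ᶠ n : ℕ in atTop, 0 ≤ E * n + t * √(V * n) + f n := by
  have hn := tendsto_natCast_atTop_atTop (R := ℝ)
  have h1 : (fun n : ℕ => t * √(V * n) + f n) =o[atTop] fun n : ℕ => (n : ℝ) := by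
    have h2 : (fun n : ℕ => √(n : ℝ)) =o[atTop] fun n : ℕ => (n : ℝ) := isLittleO_sqrt_of_tendsto hn
    refine Asymptotics.IsLittleO.add ?_ (hf.trans h2)
    simp_rw [Real.sqrt_mul hV, ← mul_assoc]
    exact h2.const_mul_left _
  filter_upwards [h1.bound hE] with n h
  rw [Real.norm_eq_abs, Real.norm_eq_abs, abs_of_nonneg (Nat.cast_nonneg n : (0 : ℝ) ≤ n)] at h
  linarith [(abs_le.1 h).1]

theorem two_rpow_neg_rpow_le_half {ℓ : ℕ} (hℓ : 1 ≤ ℓ) {θ : ℝ} (hθ : 0 ≤ θ) :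
    (2 : ℝ) ^ (-((ℓ : ℝ) ^ θ)) ≤ 1 / 2 := by
  have h : (1 : ℝ) ≤ (ℓ : ℝ) ^ θ := Real.one_le_rpow (by exact_mod_cast hℓ) hθ
  calc (2 : ℝ) ^ (-((ℓ : ℝ) ^ θ)) ≤ (2 : ℝ) ^ (-1 : ℝ) :=
        Real.rpow_le_rpow_of_exponent_le (by norm_num) (by linarith)
    _ = 1 / 2 := by
        rw [Real.rpow_neg_one]
        norm_num

theorem two_rpow_neg_rpow_lt {ℓ : ℕ} (hℓ : 2 ≤ ℓ) {a b : ℝ} :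
    (2 : ℝ) ^ (-((ℓ : ℝ) ^ a)) < (2 : ℝ) ^ (-((ℓ : ℝ) ^ b)) ↔ b < a := by
  have hl : (1 : ℝ) < ℓ := by exact_mod_cast hℓ
  rw [Real.rpow_lt_rpow_left_iff one_lt_two, neg_lt_neg_iff, Real.rpow_lt_rpow_left_iff hl]

namespace DMC

/-! ### Channels along a path -/

section PathLimits

variable {F : Type u} [Field F] [Fintype F] [DecidableEq F] {W : DMC F} {ℓ : ℕ}
  {G : Matrix (Fin ℓ) (Fin ℓ) F} {b : ℕ → Fin ℓ}

theorem tendsto_bhattMax_iter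
    (h : Tendsto (fun n => (W.iter (linKernel G) b n).symCap) atTop (𝓝 1)) :
    Tendsto (fun n => (W.iter (linKernel G) b n).bhattMax) atTop (𝓝 0) := by
  have hq : (0 : ℝ) < Fintype.card F := by exact_mod_cast Fintype.card_pos
  refine tendsto_order.2 ⟨fun a ha => Eventually.of_forall fun n =>
    ha.trans_le (bhattMax_nonneg _), fun a ha => ?_⟩
  set ε := a / (2 * Fintype.card F) with hε
  have hε0 : 0 < ε := by positivity
  have h1 : Tendsto (fun n => ε * Fintype.card F + ε⁻¹ * (Fintype.card F *
      Real.log (Fintype.card F) * (1 - (W.iter (linKernel G) b n).symCap))) atTop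
      (𝓝 (ε * Fintype.card F + ε⁻¹ * (Fintype.card F * Real.log (Fintype.card F) * (1 - 1)))) :=
    ((h.const_sub 1).const_mul _ |>.const_mul _).const_add _
  have h2 : ε * Fintype.card F +
      ε⁻¹ * (Fintype.card F * Real.log (Fintype.card F) * (1 - 1)) < a := by
    rw [sub_self, mul_zero, mul_zero, add_zero, hε]
    have : a / (2 * (Fintype.card F : ℝ)) * Fintype.card F = a / 2 := by field_simp
    rw [this]
    linarith
  filter_upwards [h1.eventually_lt_const h2] with n hn
  exact (bhattMax_le_of_symCap _ hε0).trans_lt hn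

theorem eventually_lt_bhatt_iter
    (h : Tendsto (fun n => (W.iter (linKernel G) b n).symCap) atTop (𝓝 0)) {a : ℝ} (ha : a < 1) :
    ∀ᶠ n in atTop, a < (W.iter (linKernel G) b n).bhatt := by
  have h1 : Tendsto (fun n => 1 - Fintype.card F * Real.log (Fintype.card F) *
      (W.iter (linKernel G) b n).symCap) atTop
      (𝓝 (1 - Fintype.card F * Real.log (Fintype.card F) * 0)) :=
    (h.const_mul _).const_sub 1
  rw [mul_zero, sub_zero] at h1
  filter_upwards [h1.eventually_const_lt ha] with n hn
  exact hn.trans_le (one_sub_le_bhatt _)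

theorem exists_bhatt_iter_le (hℓ : 2 ≤ ℓ) (hG : IsUnit G)
    (h : Tendsto (fun n => (W.iter (linKernel G) b n).symCap) atTop (𝓝 1))
    {E : ℝ} (hE : 0 < E) (hS : Tendsto (fun n : ℕ =>
      (∑ k ∈ Finset.range n, Real.logb ℓ (matrixDist G (b k))) / n) atTop (𝓝 E)) :
    ∃ R : ℝ, ∀ᶠ n in atTop, (W.iter (linKernel G) b n).bhatt ≤
      (2 : ℝ) ^ (-((ℓ : ℝ) ^
        ((∑ k ∈ Finset.range n, Real.logb ℓ (matrixDist G (b k))) - R))) := by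
  have hq : (1 : ℝ) ≤ Fintype.card F := by exact_mod_cast Fintype.card_pos (α := F)
  obtain ⟨R, hR⟩ := le_two_rpow_of_recursion hℓ
    (z := fun n => (W.iter (linKernel G) b n).bhattMax) (D := fun n => matrixDist G (b n))
    (one_le_pow₀ (n := ℓ) hq) (fun n => matrixDist_pos hG (b n)) (fun n => bhattMax_nonneg _)
    (fun n => bhattMax_sub_le _ G (b n)) (tendsto_bhattMax_iter h) hE hS
  exact ⟨R, hR.mono fun n hn => (bhatt_le_bhattMax _).trans hn⟩

theorem exists_le_bhatt_iter (hℓ : 2 ≤ ℓ) (hG : IsUnit G) (hW : 0 < W.bhattMin) :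
    ∃ R : ℝ, ∀ b n, (2 : ℝ) ^ (-((ℓ : ℝ) ^
      ((∑ k ∈ Finset.range n, Real.logb ℓ (matrixDist G (b k))) + R))) ≤
        (W.iter (linKernel G) b n).bhatt := by
  obtain ⟨R, hR⟩ := two_rpow_le_of_recursion hℓ hW
  exact ⟨R, fun b n => (hR (fun n => (W.iter (linKernel G) b n).bhattMin)
    (fun n => matrixDist G (b n)) rfl (fun n => matrixDist_pos hG (b n))
    (fun n => bhattMin_nonneg _) (fun n => pow_bhattMin_le _ G (b n)) n).trans
    (bhattMin_le_bhatt _)⟩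

theorem bhatt_iter_eq (hG : IsUnit G) (hD : ∀ i, matrixDist G i = 1) (b : ℕ → Fin ℓ) (n : ℕ) :
    (W.iter (linKernel G) b n).bhatt = W.bhatt := by
  induction n with
  | zero => rfl
  | succ n ih => exact (bhatt_sub_eq _ hG hD (b n)).trans ih

end PathLimits

end DMC

/-! ### Positivity of the exponents -/

section ExponentPos

variable {F : Type u} [Field F] [DecidableEq F] {ℓ : ℕ} {G : Matrix (Fin ℓ) (Fin ℓ) F}

theorem logb_matrixDist_nonneg (hℓ : 2 ≤ ℓ) (hG : IsUnit G) (i : Fin ℓ) :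
    0 ≤ Real.logb ℓ (matrixDist G i) :=
  Real.logb_nonneg (by exact_mod_cast hℓ) (by exact_mod_cast matrixDist_pos hG i)

theorem logb_matrixDist_pos (hℓ : 2 ≤ ℓ) (hG : IsUnit G) {i : Fin ℓ} (hi : matrixDist G i ≠ 1) :
    0 < Real.logb ℓ (matrixDist G i) := by
  have h : 1 < matrixDist G i := by
    have := matrixDist_pos hG i
    omega
  exact Real.logb_pos (by exact_mod_cast hℓ) (by exact_mod_cast h)

theorem exponent_pos (hℓ : 2 ≤ ℓ) (hG : IsUnit G) {i : Fin ℓ} (hi : matrixDist G i ≠ 1) :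
    0 < exponent G := by
  have hl : (0 : ℝ) < ℓ := by exact_mod_cast (by omega : 0 < ℓ)
  exact mul_pos (by positivity) (Finset.sum_pos' (fun j _ => logb_matrixDist_nonneg hℓ hG j)
    ⟨i, Finset.mem_univ i, logb_matrixDist_pos hℓ hG hi⟩)

/-- An index of distance one has logarithm 0 and contributes `E(G)² > 0`. -/
theorem secondExponent_pos (hℓ : 2 ≤ ℓ) (hG : IsUnit G) {i : Fin ℓ} (hi : matrixDist G i ≠ 1) :
    0 < secondExponent G := by
  have hl : (0 : ℝ) < ℓ := by exact_mod_cast (by omega : 0 < ℓ)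
  obtain ⟨j, hj⟩ := exists_matrixDist_eq_one (by omega) hG
  refine mul_pos (by positivity) (Finset.sum_pos' (fun j _ => sq_nonneg _)
    ⟨j, Finset.mem_univ j, ?_⟩)
  rw [hj, Nat.cast_one, Real.logb_one, zero_sub, neg_sq]
  exact pow_pos (exponent_pos hℓ hG hi) 2

end ExponentPos

/-! ### The two probability bounds and the degenerate kernel -/

section Rate

open DMC

variable {F : Type u} [Field F] [Fintype F] [DecidableEq F] {ℓ : ℕ}
  {G : Matrix (Fin ℓ) (Fin ℓ) F} {W : DMC F} {Ω : Type*} [MeasurableSpace Ω] {P : Measure Ω}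
  [IsProbabilityMeasure P] {B : ℕ → Ω → Fin ℓ}

theorem measurableSet_bhatt_iter_lt (hℓ : 0 < ℓ) (hBmeas : ∀ n, Measurable (B n)) (n : ℕ) (c : ℝ) :
    MeasurableSet {ω | (W.iter (linKernel G) (fun k => B k ω) n).bhatt < c} :=
  (dependsOnFirst_iter hℓ W (linKernel G) n fun V => V.bhatt < c).measurableSet hBmeas

/-- Since `I_∞` is 0 or 1, the event `I_∞ = 1` eventually agrees, almost surely, with `I(W_m) >
1/2`, which depends on the first `m` indices only. -/
theorem tendsto_capacity_event_inter (hℓ : 2 ≤ ℓ) (hG : IsUnit G)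
    (hBmeas : ∀ n, Measurable (B n)) (hBindep : iIndepFun B P)
    (hBunif : ∀ n i, P.real {ω | B n ω = i} = 1 / (ℓ : ℝ))
    (hpol : ∀ᵐ ω ∂P, W.limCap (linKernel G) (fun n => B n ω) ∈ ({0, 1} : Set ℝ))
    (hV : 0 < secondExponent G) {f : ℕ → ℝ} (hf : f =o[atTop] fun n : ℕ => √(n : ℝ)) (t : ℝ) :
    Tendsto (fun n : ℕ => P.real ({ω | W.limCap (linKernel G) (fun n => B n ω) = 1} ∩
      {ω | exponent G * n + t * √(secondExponent G * n) + f n <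
        ∑ k ∈ Finset.range n, Real.logb ℓ (matrixDist G (B k ω))})) atTop
      (𝓝 (W.symCap * gaussianQ t)) := by
  have hℓ0 : 0 < ℓ := by omega
  have hg := linKernel_bijective (G := G) hG
  rw [← prob_limCap_eq_one W (linKernel G) hℓ0 hg hBmeas hBindep hBunif hpol]
  refine tendsto_inter_of_approx hBmeas hBindep hBunif (fun i => Real.logb ℓ (matrixDist G i))
    rfl rfl hV t hf (measurable_limCap W (linKernel G) hℓ0 hBmeas (measurableSet_singleton 1))
    (fun m => dependsOnFirst_iter hℓ0 W (linKernel G) m fun V => 1 / 2 < V.symCap) ?_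
  filter_upwards [hpol, tendsto_symCap_iter W (linKernel G) hℓ0 hg hBmeas hBindep hBunif]
    with ω h01 hlim
  rcases h01 with h | h
  · rw [h] at hlim
    filter_upwards [hlim.eventually_lt_const (show (0 : ℝ) < 1 / 2 by norm_num)] with m hm
    simp only [h]
    constructor
    · intro h'
      linarith
    · intro h'
      norm_num at h'
  · have h' : W.limCap (linKernel G) (fun n => B n ω) = 1 := h
    rw [h'] at hlim
    filter_upwards [hlim.eventually_const_lt (show (1 / 2 : ℝ) < 1 by norm_num)] with m hm
    simp only [h', hm]

theorem le_liminf_prob_bhatt_lt (hℓ : 2 ≤ ℓ) (hG : IsUnit G)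
    (hBmeas : ∀ n, Measurable (B n)) (hBindep : iIndepFun B P)
    (hBunif : ∀ n i, P.real {ω | B n ω = i} = 1 / (ℓ : ℝ))
    (hpol : ∀ᵐ ω ∂P, W.limCap (linKernel G) (fun n => B n ω) ∈ ({0, 1} : Set ℝ))
    {i : Fin ℓ} (hi : matrixDist G i ≠ 1) {f : ℕ → ℝ}
    (hf : f =o[atTop] fun n : ℕ => √(n : ℝ)) (t : ℝ) :
    W.symCap * gaussianQ t ≤
      liminf (fun n : ℕ => P.real {ω | (W.iter (linKernel G) (fun k => B k ω) n).bhatt <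
        (2 : ℝ) ^ (-((ℓ : ℝ) ^ (exponent G * n + t * √(secondExponent G * n) + f n)))})
        atTop := by
  have hℓ0 : 0 < ℓ := by omega
  have hg := linKernel_bijective (G := G) hG
  -- The offset `R` in the bound on `Z` depends on the path. The slack `√√n` eventually exceeds each
  -- such `R` and is still `o(√n)`.
  have hf' : (fun n : ℕ => f n + √√(n : ℝ)) =o[atTop] fun n : ℕ => √(n : ℝ) :=
    hf.add (isLittleO_sqrt_of_tendsto
      (Real.tendsto_sqrt_atTop.comp tendsto_natCast_atTop_atTop))
  have hmain := tendsto_capacity_event_inter (W := W) hℓ hG hBmeas hBindep hBunif hpol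
    (secondExponent_pos hℓ hG hi) hf' t
  set A := {ω | W.limCap (linKernel G) (fun n => B n ω) = 1} with hA
  set S : ℕ → Set Ω := fun n => {ω | exponent G * n + t * √(secondExponent G * n) +
    (f n + √√(n : ℝ)) < ∑ k ∈ Finset.range n, Real.logb ℓ (matrixDist G (B k ω))} with hS
  set T : ℕ → Set Ω := fun n => {ω | (W.iter (linKernel G) (fun k => B k ω) n).bhatt <
    (2 : ℝ) ^ (-((ℓ : ℝ) ^ (exponent G * n + t * √(secondExponent G * n) + f n)))} with hT
  have hAm : MeasurableSet A :=
    measurable_limCap W (linKernel G) hℓ0 hBmeas (measurableSet_singleton 1)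
  have hSm : ∀ n, MeasurableSet (S n) := fun n =>
    measurableSet_lt measurable_const (Finset.measurable_fun_sum _ fun k _ =>
      (measurable_from_top (f := fun i => Real.logb ℓ (matrixDist G i))).comp (hBmeas k))
  have hTm : ∀ n, MeasurableSet (T n) := fun n => measurableSet_bhatt_iter_lt hℓ0 hBmeas n _
  have hbad := tendsto_measureReal_of_eventually_notMem (P := P)
    (s := fun n => (A ∩ S n) \ T n) (fun n => (hAm.inter (hSm n)).diff (hTm n)) (by
      filter_upwards [tendsto_symCap_iter W (linKernel G) hℓ0 hg hBmeas hBindep hBunif,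
        tendsto_average_uniform hBmeas hBindep hBunif
          fun i => Real.logb ℓ (matrixDist G i)] with ω hlim hav
      by_cases hωA : ω ∈ A
      · have h1 : W.limCap (linKernel G) (fun n => B n ω) = 1 := hωA
        rw [h1] at hlim
        obtain ⟨R, hR⟩ := exists_bhatt_iter_le hℓ hG hlim (exponent_pos hℓ hG hi) hav
        filter_upwards [hR, tendsto_sqrt_sqrt_atTop.eventually_ge_atTop R] with n hn hRn
        rintro ⟨⟨-, hωS⟩, hωT⟩
        refine hωT (lt_of_le_of_lt hn ((two_rpow_neg_rpow_lt hℓ).2 ?_))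
        simp only [hS, Set.mem_ofPred_eq] at hωS
        linarith
      · exact Eventually.of_forall fun n h => hωA h.1.1)
  have hlim := hmain.sub hbad
  rw [sub_zero] at hlim
  refine le_liminf_of_tendsto_of_le (c := 1) hlim (Eventually.of_forall fun n => ?_)
    fun n => measureReal_le_one
  have h1 : A ∩ S n ⊆ T n ∪ ((A ∩ S n) \ T n) := fun ω hω => by
    by_cases h : ω ∈ T n
    · exact Or.inl h
    · exact Or.inr ⟨hω, h⟩
  have h2 := (measureReal_mono (μ := P) h1).trans (measureReal_union_le _ _)
  linarith

theorem limsup_prob_bhatt_lt_le (hℓ : 2 ≤ ℓ) (hG : IsUnit G)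
    (hBmeas : ∀ n, Measurable (B n)) (hBindep : iIndepFun B P)
    (hBunif : ∀ n i, P.real {ω | B n ω = i} = 1 / (ℓ : ℝ))
    (hpol : ∀ᵐ ω ∂P, W.limCap (linKernel G) (fun n => B n ω) ∈ ({0, 1} : Set ℝ))
    {i : Fin ℓ} (hi : matrixDist G i ≠ 1) {f : ℕ → ℝ}
    (hf : f =o[atTop] fun n : ℕ => √(n : ℝ)) (t : ℝ) (hW : 0 < W.bhattMin) :
    limsup (fun n : ℕ => P.real {ω | (W.iter (linKernel G) (fun k => B k ω) n).bhatt <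
      (2 : ℝ) ^ (-((ℓ : ℝ) ^ (exponent G * n + t * √(secondExponent G * n) + f n)))})
      atTop ≤ W.symCap * gaussianQ t := by
  have hℓ0 : 0 < ℓ := by omega
  have hg := linKernel_bijective (G := G) hG
  obtain ⟨R, hR⟩ := exists_le_bhatt_iter hℓ hG hW
  have hmain := tendsto_capacity_event_inter (W := W) hℓ hG hBmeas hBindep hBunif hpol
    (secondExponent_pos hℓ hG hi) (hf.sub (isLittleO_const_sqrt R)) t
  set A := {ω | W.limCap (linKernel G) (fun n => B n ω) = 1} with hA
  set S : ℕ → Set Ω := fun n => {ω | exponent G * n + t * √(secondExponent G * n) +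
    (f n - R) < ∑ k ∈ Finset.range n, Real.logb ℓ (matrixDist G (B k ω))} with hS
  set T : ℕ → Set Ω := fun n => {ω | (W.iter (linKernel G) (fun k => B k ω) n).bhatt <
    (2 : ℝ) ^ (-((ℓ : ℝ) ^ (exponent G * n + t * √(secondExponent G * n) + f n)))} with hT
  have hAm : MeasurableSet A :=
    measurable_limCap W (linKernel G) hℓ0 hBmeas (measurableSet_singleton 1)
  have hTm : ∀ n, MeasurableSet (T n) := fun n => measurableSet_bhatt_iter_lt hℓ0 hBmeas n _
  -- The inclusion holds for every outcome and every `n` because `R` is deterministic here.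
  have hTS : ∀ n, T n ⊆ S n := by
    intro n ω hω
    have h := (two_rpow_neg_rpow_lt hℓ).1 ((hR (fun k => B k ω) n).trans_lt hω)
    simp only [hS, Set.mem_ofPred_eq]
    linarith
  have hbad := tendsto_measureReal_of_eventually_notMem (P := P)
    (s := fun n => T n \ A) (fun n => (hTm n).diff hAm) (by
      filter_upwards [hpol,
        tendsto_symCap_iter W (linKernel G) hℓ0 hg hBmeas hBindep hBunif] with ω h01 hlim
      rcases h01 with h | h
      · rw [h] at hlim
        filter_upwards [eventually_lt_bhatt_iter hlim (show (1 / 2 : ℝ) < 1 by norm_num),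
          eventually_threshold_nonneg (t := t) (exponent_pos hℓ hG hi)
            (secondExponent_pos hℓ hG hi).le hf] with n hn hθ
        rintro ⟨hωT, -⟩
        exact absurd (hωT.trans_le (two_rpow_neg_rpow_le_half hℓ0 hθ)) (not_lt.2 hn.le)
      · exact Eventually.of_forall fun n h' => h'.2 h)
  have hlim := hmain.add hbad
  rw [add_zero] at hlim
  refine limsup_le_of_le_tendsto (c := 0) hlim (Eventually.of_forall fun n => ?_)
    fun n => measureReal_nonneg
  have h1 : T n ⊆ (A ∩ S n) ∪ (T n \ A) := fun ω hω => by
    by_cases h : ω ∈ A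
    · exact Or.inl ⟨h, hTS n hω⟩
    · exact Or.inr ⟨hω, h⟩
  exact (measureReal_mono (μ := P) h1).trans (measureReal_union_le _ _)

/-- If all partial distances are one, the kernel does not change `Z`, so a polarizing channel is
already perfect or useless. -/
theorem symCap_eq_one_of_matrixDist_eq_one (hℓ : 2 ≤ ℓ) (hG : IsUnit G)
    (hBmeas : ∀ n, Measurable (B n)) (hBindep : iIndepFun B P)
    (hBunif : ∀ n i, P.real {ω | B n ω = i} = 1 / (ℓ : ℝ))
    (hpol : ∀ᵐ ω ∂P, W.limCap (linKernel G) (fun n => B n ω) ∈ ({0, 1} : Set ℝ))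
    (hD : ∀ i, matrixDist G i = 1) (hW : W.symCap ≠ 0) : W.symCap = 1 := by
  have hℓ0 : 0 < ℓ := by omega
  have hg := linKernel_bijective (G := G) hG
  have hZ : W.bhatt < 1 := by
    by_contra! h
    exact hW (W.symCap_eq_zero_of_bhatt h)
  rw [← prob_limCap_eq_one W (linKernel G) hℓ0 hg hBmeas hBindep hBunif hpol]
  have h : ∀ᵐ ω ∂P, ω ∈ {ω | W.limCap (linKernel G) (fun n => B n ω) = 1} := by
    filter_upwards [hpol,
      tendsto_symCap_iter W (linKernel G) hℓ0 hg hBmeas hBindep hBunif] with ω h01 hlim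
    rcases h01 with h | h
    · rw [h] at hlim
      -- If `I → 0`, then `Z` would eventually exceed `Z(W) < 1`, yet it is constant along the path.
      obtain ⟨n, hn⟩ := (eventually_lt_bhatt_iter hlim hZ).exists
      rw [bhatt_iter_eq hG hD] at hn
      exact absurd hn (lt_irrefl _)
    · exact h
  have hset : MeasurableSet {ω | W.limCap (linKernel G) (fun n => B n ω) = 1} :=
    measurable_limCap W (linKernel G) hℓ0 hBmeas (measurableSet_singleton 1)
  rw [Measure.real, (prob_compl_eq_zero_iff hset).1 h, ENNReal.toReal_one]

/-- The capacities at time `n` are nonnegative with mean `I(W) = 0`, so they vanish almost surely.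
-/
theorem ae_one_le_bhatt_iter (hℓ : 2 ≤ ℓ) (hG : IsUnit G)
    (hBmeas : ∀ n, Measurable (B n)) (hBindep : iIndepFun B P)
    (hBunif : ∀ n i, P.real {ω | B n ω = i} = 1 / (ℓ : ℝ)) (hW : W.symCap = 0) (n : ℕ) :
    ∀ᵐ ω ∂P, 1 ≤ (W.iter (linKernel G) (fun k => B k ω) n).bhatt := by
  have hℓ0 : 0 < ℓ := by omega
  have h := integral_symCap_iter W (linKernel G) hℓ0 (linKernel_bijective hG) hBmeas hBindep
    hBunif n
  rw [hW, integral_eq_zero_iff_of_nonneg (fun ω => symCap_nonneg _)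
    (integrable_symCap_iter W (linKernel G) hℓ0 hBmeas n)] at h
  filter_upwards [h] with ω hω
  have h1 := one_sub_le_bhatt (W.iter (linKernel G) (fun k => B k ω) n)
  have h2 : (W.iter (linKernel G) (fun k => B k ω) n).symCap = 0 := hω
  rwa [h2, mul_zero, sub_zero] at h1

end Rate

theorem mainTheorem4 {F : Type u} [Field F] [Fintype F] [DecidableEq F]
    {ℓ : ℕ} (hℓ : 2 ≤ ℓ) (G : Matrix (Fin ℓ) (Fin ℓ) F) (hG : IsUnit G)
    (W : DMC F)
    {Ω : Type*} [MeasurableSpace Ω] (P : Measure Ω) [IsProbabilityMeasure P]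
    (B : ℕ → Ω → Fin ℓ) (hBmeas : ∀ n, Measurable (B n)) (hBindep : iIndepFun B P)
    (hBunif : ∀ n i, P.real {ω | B n ω = i} = 1 / (ℓ : ℝ))
    (hpol : ∀ᵐ ω ∂P, W.limCap (linKernel G) (fun n => B n ω) ∈ ({0, 1} : Set ℝ))
    (f : ℕ → ℝ) (hf : f =o[atTop] fun n : ℕ => Real.sqrt (n : ℝ)) (t : ℝ) :
    W.symCap * gaussianQ t ≤
        liminf (fun n : ℕ => P.real {ω | (W.iter (linKernel G) (fun k => B k ω) n).bhatt <
          (2 : ℝ) ^ (-((ℓ : ℝ) ^ (exponent G * n + t * Real.sqrt (secondExponent G * n) + f n)))})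
          atTop ∧
      (0 < W.bhattMin →
        limsup (fun n : ℕ => P.real {ω | (W.iter (linKernel G) (fun k => B k ω) n).bhatt <
          (2 : ℝ) ^ (-((ℓ : ℝ) ^ (exponent G * n + t * Real.sqrt (secondExponent G * n) + f n)))})
          atTop ≤ W.symCap * gaussianQ t) := by
  -- This is the case `V(G) = 0`, where no central limit theorem is available.
  by_cases hD : ∀ i, matrixDist G i = 1
  · by_cases hW : W.symCap = 0
    · have h0 : ∀ n : ℕ, P.real {ω | (W.iter (linKernel G) (fun k => B k ω) n).bhatt <
          (2 : ℝ) ^ (-((ℓ : ℝ) ^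
            (exponent G * n + t * Real.sqrt (secondExponent G * n) + f n)))} = 0 := by
        intro n
        rw [measureReal_eq_zero_iff]
        refine measure_mono_null (fun ω h => ?_)
          (ae_iff.1 (ae_one_le_bhatt_iter hℓ hG hBmeas hBindep hBunif hW n))
        intro hω
        have h1 : (2 : ℝ) ^ (-((ℓ : ℝ) ^
            (exponent G * n + t * Real.sqrt (secondExponent G * n) + f n))) ≤ 1 :=
          Real.rpow_le_one_of_one_le_of_nonpos (by norm_num) (neg_nonpos.2 (by positivity))
        exact absurd (h.trans_le h1) (not_lt.2 hω)
      simp only [h0, hW, zero_mul, liminf_const, limsup_const, le_refl, implies_true, and_self]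
    · have hW1 := symCap_eq_one_of_matrixDist_eq_one hℓ hG hBmeas hBindep hBunif hpol hD hW
      have hZ := W.bhattMax_eq_zero_of_symCap_eq_one hW1
      have h1 : ∀ n : ℕ, P.real {ω | (W.iter (linKernel G) (fun k => B k ω) n).bhatt <
          (2 : ℝ) ^ (-((ℓ : ℝ) ^
            (exponent G * n + t * Real.sqrt (secondExponent G * n) + f n)))} = 1 := by
        intro n
        have huniv : {ω | (W.iter (linKernel G) (fun k => B k ω) n).bhatt <
            (2 : ℝ) ^ (-((ℓ : ℝ) ^
              (exponent G * n + t * Real.sqrt (secondExponent G * n) + f n)))} = Set.univ := by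
          refine Set.eq_univ_of_forall fun ω => ?_
          refine lt_of_le_of_lt ?_ (Real.rpow_pos_of_pos two_pos _)
          rw [DMC.bhatt_iter_eq hG hD, ← hZ]
          exact W.bhatt_le_bhattMax
        rw [huniv, probReal_univ]
      -- A perfect channel has `Z_max = 0`, so `Z_min > 0` is impossible and the upper bound is
      -- vacuous.
      refine ⟨?_, fun hmin => absurd (W.bhattMin_le_bhattMax.trans hZ.le) (not_le.2 hmin)⟩
      simp only [h1, hW1, one_mul, liminf_const]
      exact gaussianQ_le_one t
  · push Not at hD
    obtain ⟨i, hi⟩ := hD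
    exact ⟨le_liminf_prob_bhatt_lt hℓ hG hBmeas hBindep hBunif hpol hi hf t,
      limsup_prob_bhatt_lt_le hℓ hG hBmeas hBindep hBunif hpol hi hf t⟩
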